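/- Let $\rho_1,\rho_2,k,b,\gamma,L,T>0$, $H^1_*(0,L)=\{w\in H^1(0,L): w(0)=0\}$ and $\mathcal H=[H^1_*(0,L)\times L^2(0,L)]^3\times\mathbb R^3$. Let $\mathcal A$ be the operator in $\mathcal H$ that maps $U=(w,\Psi_1,\xi,\Psi_2,s,\Psi_3,\Psi_4,\Psi_5,\Psi_6)$ to $$\Big(\Psi_1,\tfrac{k}{\rho_1}(w_x+\xi+s)_x,\ \Psi_2,\tfrac1{\rho_2}[b\xi_{xx}-k(w_x+\xi+s)],\ \Psi_3,\tfrac1{\rho_2}[bs_{xx}-3k(w_x+\xi+s)-\gamma s],\ -(w_x+\xi+s)(L),\,-\xi_x(L),\,-s_x(L)\Big),$$ with domain $D(\mathcal A)$ given by $w,\xi,s\in H^2(0,L)\cap H^1_*(0,L)$, $\Psi_1,\Psi_2,\Psi_3\in H^1_*(0,L)$, $\Psi_4=\Psi_1(L)$, $\Psi_5=\Psi_2(L)$, $\Psi_6=\Psi_3(L)$ (with the graph norm). **Controlled system.** For $u_1,u_2,u_3\in L^2(0,T)$ consider, on $(0,L)\times(0,T)$, $$\begin{cases}\rho_1w_{tt}-k(w_x+\xi+s)_x=0,\\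 \rho_2\xi_{tt}-b\xi_{xx}+k(w_x+\xi+s)=0,\\ \rho_2s_{tt}-bs_{xx}+3k(w_x+\xi+s)+\gamma s=0,\\ w=\xi=s=0\ \text{ at } x=0,\\ w_{tt}+w_x+\xi+s=u_1,\quad \xi_{tt}+\xi_x=u_2,\quad s_{tt}+s_x=u_3\ \text{ at } x=L.\end{cases}$$ The initial datum $U_0$ consists of $w_0,\xi_0,s_0\in L^2(0,L)$, $w_1,\xi_1,s_1\in H^1_*(0,L)'$ and real numbers $w(L,0),\xi(L,0),s(L,0)$, $w_t(L,0),\xi_t(L,0),s_t(L,0)$. **Adjoint system.** A solution of the adjoint system on $[0,\tau]$ is a mild solution $W=(\chi,\chi_t,\eta,\eta_t,\Theta,\Theta_t,\chi_t(L,\cdot),\eta_t(L,\cdot),\Theta_t(L,\cdot))\in C([0,\tau];\mathcal H)$ of $W_t=\mathcal AW$, i.e. of the system above with zero controls (in particular $\eta_{tt}(L,t)+\eta_x(L,t)=0$), with an arbitrary final state $W(\tau)\in\mathcal H$; mild means that $\int_\tau^tW\in D(\mathcal A)$ and $W(t)-W(\tau)=\mathcal A\int_\tau^tW$ for all $t\in[0,\tau]$.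 **Solutions and controllability.** For $W\in\mathcal H$ and a datum $V=(v_0,v_1,\zeta_0,\zeta_1,r_0,r_1)$ together with its boundary values, let $\langle V,W\rangle_*$ be the $\mathcal H'\times\mathcal H$ duality of $(3\rho_1v_1,-3\rho_1v_0,3\rho_2\zeta_1,-3\rho_2\zeta_0,\rho_2r_1,-\rho_2r_0,-3kv(L),-3b\zeta(L),-br(L))$ with $W$. A solution by transposition of the controlled system is a function $U=(w,w_t,\xi,\xi_t,s,s_t,w_t(L),\xi_t(L),s_t(L))\in C([0,T];D(\mathcal A))$ such that for all $\tau\in[0,T]$ and every solution $W$ of the adjoint system on $[0,\tau]$ with $(\chi,\eta,\Theta)(L,\tau)=0$, $$\begin{aligned}\langle U(\tau),W(\tau)\rangle_*=\ &\langle U_0,W(0)\rangle_*+3kw_t(L,0)\chi(L,0)+3b\xi_t(L,0)\eta(L,0)+bs_t(L,0)\Theta(L,0)\\&+\int_0^\tau\big(3ku_1\chi(L,t)+3bu_2\eta(L,t)+bu_3\Theta(L,t)\big)dt.\end{aligned}$$ The controls $u_1,u_2,u_3$ steer $U_0$ to zero in time $T$ if such a $U$ exists with $U(T)=0$. **Lemma.**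 For given $U_0$ and given $u_1,u_2,u_3\in L^2(0,T)$, the controls $u_1,u_2,u_3$ steer $U_0$ to zero in time $T$ if and only if for every solution $W$ of the adjoint system on $[0,T]$ (with any final state in $\mathcal H$) $$\begin{aligned}&-\langle U_0,W(0)\rangle_*-\big(3kw_t(L,0)\chi(L,0)+3b\xi_t(L,0)\eta(L,0)+bs_t(L,0)\Theta(L,0)\big)\\&\quad=3k\int_0^Tu_1(t)\chi(L,t)\,dt+3b\int_0^Tu_2(t)\eta(L,t)\,dt+b\int_0^Tu_3(t)\Theta(L,t)\,dt.\end{aligned}$$ -/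

import Mathlib

open MeasureTheory Set Filter Topology

noncomputable section

namespace LaminatedBeam

/-- The space `L²(0, L)`. -/
abbrev L2 (L : ℝ) : Type := Lp ℝ 2 (volume.restrict (Ioo (0 : ℝ) L))

/-- `IsH1 L f g f₀ f₁`: the function `f ∈ L²(0, L)` belongs to `H¹(0, L)`, its derivative is
`g ∈ L²(0, L)`, and the values of its absolutely continuous representative at the end points are
`f(0) = f₀` and `f(L) = f₁`. -/
def IsH1 (L : ℝ) (f g : L2 L) (f₀ f₁ : ℝ) : Prop :=
  (∀ᵐ x ∂(volume.restrict (Ioo (0 : ℝ) L)), f x = f₀ + ∫ y in (0 : ℝ)..x, g y) ∧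
    f₁ = f₀ + ∫ y in (0 : ℝ)..L, g y

theorem intervalIntegrable_L2 {L x : ℝ} (hx : x ∈ Ioo (0 : ℝ) L) (g : L2 L) :
    IntervalIntegrable (fun y => g y) volume 0 x := by
  have h : Integrable (fun y => g y) (volume.restrict (Ioo (0 : ℝ) L)) :=
    (Lp.memLp g).integrable (by norm_num)
  have h' : IntegrableOn (fun y => g y) (Ioo (0 : ℝ) L) volume := h
  rw [intervalIntegrable_iff_integrableOn_Ioc_of_le hx.1.le]
  exact h'.mono_set (fun y hy => ⟨hy.1, hy.2.trans_lt hx.2⟩)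

theorem primitive_eq_inner {L x : ℝ} (hx : x ∈ Ioo (0 : ℝ) L) (g : L2 L) :
    ∫ y in (0 : ℝ)..x, g y =
      inner ℝ (indicatorConstLp 2 (μ := volume.restrict (Ioo (0 : ℝ) L))
        (measurableSet_Ioc (a := (0 : ℝ)) (b := x)) (measure_ne_top _ _) (1 : ℝ)) g := by
  rw [L2.inner_indicatorConstLp_one, intervalIntegral.integral_of_le hx.1.le,
    Measure.restrict_restrict measurableSet_Ioc]
  congr 2
  ext y
  exact ⟨fun hy => ⟨hy, hy.1, hy.2.trans_lt hx.2⟩, fun hy => hy.1⟩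

/-- The space `H¹_*(0, L) = {w ∈ H¹(0, L) : w(0) = 0}`, realised as the space of the pairs
`(w, w_x) ∈ L²(0, L) × L²(0, L)`, with the norm induced by `L² × L²` (an `H¹` norm). -/
def H1Star (L : ℝ) : Submodule ℝ (L2 L × L2 L) where
  carrier := {p | ∃ c : ℝ, IsH1 L p.1 p.2 0 c}
  zero_mem' := by
    refine ⟨_, ?_, rfl⟩
    filter_upwards [Lp.coeFn_zero ℝ 2 (volume.restrict (Ioo (0 : ℝ) L)),
      ae_restrict_mem measurableSet_Ioo] with x h1 hx
    rw [primitive_eq_inner hx]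
    simpa using h1
  add_mem' := by
    rintro p q ⟨_, hp, -⟩ ⟨_, hq, -⟩
    refine ⟨_, ?_, rfl⟩
    filter_upwards [hp, hq, Lp.coeFn_add p.1 q.1, ae_restrict_mem measurableSet_Ioo]
      with x h1 h2 h3 hx
    rw [primitive_eq_inner hx] at *
    simp only [Prod.fst_add, Prod.snd_add, h3, Pi.add_apply, h1, h2, inner_add_right]
    ring
  smul_mem' := by
    rintro c p ⟨_, hp, -⟩
    refine ⟨_, ?_, rfl⟩
    filter_upwards [hp, Lp.coeFn_smul c p.1, ae_restrict_mem measurableSet_Ioo] with x h1 h3 hx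
    rw [primitive_eq_inner hx] at *
    simp only [Prod.smul_fst, Prod.smul_snd, h3, Pi.smul_apply, h1, inner_smul_right, smul_eq_mul]
    ring

theorem isClosed_H1Star (L : ℝ) : IsClosed (H1Star L : Set (L2 L × L2 L)) := by
  refine IsSeqClosed.isClosed ?_
  intro p q hp hq
  have h1 : Tendsto (fun n => (p n).1) atTop (𝓝 q.1) := (continuous_fst.tendsto q).comp hq
  have h2 : Tendsto (fun n => (p n).2) atTop (𝓝 q.2) := (continuous_snd.tendsto q).comp hq
  obtain ⟨ns, hns, hae⟩ := (tendstoInMeasure_of_tendsto_Lp h1).exists_seq_tendsto_ae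
  have hall : ∀ᵐ x ∂(volume.restrict (Ioo (0 : ℝ) L)), ∀ n,
      (p n).1 x = 0 + ∫ y in (0 : ℝ)..x, (p n).2 y :=
    ae_all_iff.2 fun n => by
      obtain ⟨_, h, -⟩ := hp n
      exact h
  refine ⟨_, ?_, rfl⟩
  filter_upwards [hae, hall, ae_restrict_mem measurableSet_Ioo] with x hx1 hx2 hx
  refine tendsto_nhds_unique hx1 ?_
  simp only [hx2, primitive_eq_inner hx]
  exact (tendsto_const_nhds.inner (h2.comp hns.tendsto_atTop)).const_add 0

instance (L : ℝ) : CompleteSpace (H1Star L) := (isClosed_H1Star L).completeSpace_coe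

section H1Star

variable {L : ℝ}

/-- The underlying element `w` of `L²(0, L)`. -/
def fn (w : H1Star L) : L2 L := (w : L2 L × L2 L).1

/-- The derivative `w_x ∈ L²(0, L)`. -/
def dx (w : H1Star L) : L2 L := (w : L2 L × L2 L).2

/-- The boundary value `w(L)` (recall that `w(0) = 0`). -/
def atL (w : H1Star L) : ℝ := ∫ y in (0 : ℝ)..L, dx w y

end H1Star

/-- The phase space `H = [H¹_*(0, L) × L²(0, L)]³ × ℝ³`, with the factors grouped as
`((w, ξ, s), (Ψ₁, Ψ₂, Ψ₃), (Ψ₄, Ψ₅, Ψ₆))`. -/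
abbrev Phase (L : ℝ) : Type := (Fin 3 → H1Star L) × (Fin 3 → L2 L) × (Fin 3 → ℝ)

namespace Phase

variable {L : ℝ}

/-- The components `(w, ξ, s)`. -/
def pos (U : Phase L) : Fin 3 → H1Star L := U.1

/-- The components `(Ψ₁, Ψ₂, Ψ₃)`, which stand for `(w_t, ξ_t, s_t)`. -/
def vel (U : Phase L) : Fin 3 → L2 L := U.2.1

/-- The components `(Ψ₄, Ψ₅, Ψ₆)`, which stand for `(w_t(L), ξ_t(L), s_t(L))`. -/
def bvel (U : Phase L) : Fin 3 → ℝ := U.2.2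

end Phase

/-- The physical constants of the beam. -/
structure Params where
  /-- density -/
  ρ₁ : ℝ
  /-- mass moment of inertia -/
  ρ₂ : ℝ
  /-- shear stiffness -/
  k : ℝ
  /-- flexural rigidity -/
  b : ℝ
  /-- adhesive stiffness -/
  γ : ℝ
  /-- length of the beam -/
  L : ℝ

/-- All constants are positive. -/
def Params.Positive (p : Params) : Prop :=
  0 < p.ρ₁ ∧ 0 < p.ρ₂ ∧ 0 < p.k ∧ 0 < p.b ∧ 0 < p.γ ∧ 0 < p.L

/-- `IsGen p U F`: the state `U` lies in the domain `D(𝒜)` and `𝒜 U = F`, where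
`𝒜 (w, Ψ₁, ξ, Ψ₂, s, Ψ₃, Ψ₄, Ψ₅, Ψ₆)` is
`(Ψ₁, (k/ρ₁)(w_x+ξ+s)_x, Ψ₂, (1/ρ₂)(b ξ_xx - k(w_x+ξ+s)), Ψ₃,
  (1/ρ₂)(b s_xx - 3k(w_x+ξ+s) - γ s), -(w_x(L)+ξ(L)+s(L)), -ξ_x(L), -s_x(L))`,
and `D(𝒜)` asks for `w, ξ, s ∈ H² ∩ H¹_*`, `Ψ₁, Ψ₂, Ψ₃ ∈ H¹_*` and
`Ψ₄ = Ψ₁(L)`, `Ψ₅ = Ψ₂(L)`, `Ψ₆ = Ψ₃(L)`.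
Here `dd` are the second derivatives and `d₀`, `dL` the end point values of the first ones. -/
def IsGen (p : Params) (U F : Phase p.L) : Prop :=
  ∃ (dd : Fin 3 → L2 p.L) (d₀ dL : Fin 3 → ℝ),
    (∀ i, IsH1 p.L (dx (U.pos i)) (dd i) (d₀ i) (dL i)) ∧
    (∀ i, fn (F.pos i) = U.vel i) ∧
    (∀ i, U.bvel i = atL (F.pos i)) ∧
    F.vel 0 = (1 / p.ρ₁) • (p.k • (dd 0 + dx (U.pos 1) + dx (U.pos 2))) ∧
    F.vel 1 = (1 / p.ρ₂) •
      (p.b • dd 1 - p.k • (dx (U.pos 0) + fn (U.pos 1) + fn (U.pos 2))) ∧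
    F.vel 2 = (1 / p.ρ₂) •
      (p.b • dd 2 - (3 * p.k) • (dx (U.pos 0) + fn (U.pos 1) + fn (U.pos 2))
        - p.γ • fn (U.pos 2)) ∧
    F.bvel 0 = -(dL 0 + atL (U.pos 1) + atL (U.pos 2)) ∧
    F.bvel 1 = -(dL 1) ∧
    F.bvel 2 = -(dL 2)

/-- The solutions on `[0, τ]` of the adjoint system with arbitrary final state `W τ` in the
phase space.  In terms of `W = (χ, χ_t, η, η_t, Θ, Θ_t, χ_t(L), η_t(L), Θ_t(L))` the adjoint system
is `W_t = 𝒜 W`, understood in the mild sense: `W` is continuous with values in the phase space,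
`∫_τ^t W` lies in `D(𝒜)` and `W(t) - W(τ) = 𝒜 ∫_τ^t W`. -/
def IsAdjointSolution (p : Params) (τ : ℝ) (W : ℝ → Phase p.L) : Prop :=
  ContinuousOn W (Icc 0 τ) ∧
    ∀ t ∈ Icc 0 τ, IsGen p (∫ r in τ..t, W r) (W t - W τ)

/-- Initial data in the dual scale: `(w₀, ξ₀, s₀)` in `L²(0, L)`, `(w₁, ξ₁, s₁)` in the dual
of `H¹_*(0, L)`, and the boundary values `(w, ξ, s)(L, 0)` and `(w_t, ξ_t, s_t)(L, 0)`, which are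
data of their own at this regularity. -/
structure DualDatum (L : ℝ) where
  /-- `(w₀, ξ₀, s₀)` -/
  pos : Fin 3 → L2 L
  /-- `(w₁, ξ₁, s₁)` -/
  vel : Fin 3 → StrongDual ℝ (H1Star L)
  /-- `(w(L, 0), ξ(L, 0), s(L, 0))` -/
  bpos : Fin 3 → ℝ
  /-- `(w_t(L, 0), ξ_t(L, 0), s_t(L, 0))` -/
  bvel : Fin 3 → ℝ

/-- A state of the phase space, read as a datum in the dual scale: a velocity in `L²(0, L)` acts
on `H¹_*(0, L)` by the inner product of `L²(0, L)`. -/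
def Phase.toDual {L : ℝ} (U : Phase L) : DualDatum L where
  pos i := fn (U.pos i)
  vel i := (innerSL ℝ (U.vel i)).comp
    ((ContinuousLinearMap.fst ℝ (L2 L) (L2 L)).comp (H1Star L).subtypeL)
  bpos i := atL (U.pos i)
  bvel := U.bvel

/-- The weights `(3ρ₁, 3ρ₂, ρ₂)`. -/
def Params.mass (p : Params) : Fin 3 → ℝ := ![3 * p.ρ₁, 3 * p.ρ₂, p.ρ₂]

/-- The weights `(3k, 3b, b)`. -/
def Params.bweight (p : Params) : Fin 3 → ℝ := ![3 * p.k, 3 * p.b, p.b]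

/-- The duality of
`(3ρ₁w₁, -3ρ₁w₀, 3ρ₂ξ₁, -3ρ₂ξ₀, ρ₂s₁, -ρ₂s₀, -3k w(L), -3b ξ(L), -b s(L))` with the element
`(χ, χ_t, η, η_t, Θ, Θ_t, χ_t(L), η_t(L), Θ_t(L))` of the phase space. -/
def pairing (p : Params) (D : DualDatum p.L) (W : Phase p.L) : ℝ :=
  ∑ i, (p.mass i * D.vel i (W.pos i) - p.mass i * inner ℝ (D.pos i) (W.vel i)
    - p.bweight i * D.bpos i * W.bvel i)

/-- The Euclidean product of `(3k w_t(L), 3b ξ_t(L), b s_t(L))` with `(χ(L), η(L), Θ(L))`. -/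
def boundaryPairing (p : Params) (D : DualDatum p.L) (W : Phase p.L) : ℝ :=
  ∑ i, p.bweight i * D.bvel i * atL (W.pos i)

/-- `∫_0^τ (3k u₁(t) χ(L, t) + 3b u₂(t) η(L, t) + b u₃(t) Θ(L, t)) dt`. -/
def controlPairing (p : Params) (τ : ℝ) (u : Fin 3 → ℝ → ℝ) (W : ℝ → Phase p.L) : ℝ :=
  ∑ i, p.bweight i * ∫ t in (0 : ℝ)..τ, u i t * atL ((W t).pos i)

/-- Solutions by transposition, on `[0, T]`, of the system with boundary controls `u` and initial
datum `D`: `U = (w, w_t, ξ, ξ_t, s, s_t, w_t(L), ξ_t(L), s_t(L)) ∈ C([0, T]; D(𝒜))` (the domain has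
the graph norm), and for every `τ ∈ [0, T]` the duality identity holds for every solution of
the adjoint system on `[0, τ]` with `(χ, η, Θ)(L, τ) = 0`. -/
def IsTranspositionSolution (p : Params) (T : ℝ) (u : Fin 3 → ℝ → ℝ) (D : DualDatum p.L)
    (U : ℝ → Phase p.L) : Prop :=
  (∃ AU : ℝ → Phase p.L, (∀ t ∈ Icc 0 T, IsGen p (U t) (AU t)) ∧
      ContinuousOn U (Icc 0 T) ∧ ContinuousOn AU (Icc 0 T)) ∧
    (∀ t ∈ Icc 0 T, ∀ i,
      HasDerivWithinAt (fun r => fn ((U r).pos i)) ((U t).vel i) (Icc 0 T) t) ∧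
    ∀ τ ∈ Icc 0 T, ∀ W : ℝ → Phase p.L, IsAdjointSolution p τ W →
      (∀ i, atL ((W τ).pos i) = 0) →
      pairing p (U τ).toDual (W τ) =
        pairing p D (W 0) + controlPairing p τ u W + boundaryPairing p D (W 0)

/-- The controls `u` steer the initial datum `D` to zero in time `T`. -/
def SteersToZero (p : Params) (T : ℝ) (u : Fin 3 → ℝ → ℝ) (D : DualDatum p.L) : Prop :=
  ∃ U : ℝ → Phase p.L, IsTranspositionSolution p T u D U ∧ U T = 0

end LaminatedBeam

end

/-! The system is Hamiltonian. With `energy` the energy form and `symp` the antisymmetric form that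
completes `pairing`, `IsGen p U F` holds iff `energy p U W = -symp p F W` for all `W`
(`isGen_iff_energy`). The energy is coercive and `symp` is nondegenerate, so the generator has a
bounded injective inverse `R`, skew for the energy, and `exists_isometric_group` produces from it a
group `S` that preserves both forms. The adjoint solutions are exactly the orbits of `S`. The
controls enter as `U' = 𝒜U + ∑ uᵢ bᵢ` with `bᵢ = bvec p.L i`: in the energy `bᵢ` reads a boundary
velocity, in `symp` it reads a displacement at `L`.

Sufficiency: solve backwards from the zero state at time `T` by Duhamel's formula. Pairing the
result at time `τ` with an orbit gives minus the control integral over `[τ, T]`, so the moment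
identity becomes the transposition identity for every `τ`. The substantial point is continuity in
the graph norm, since `bᵢ` is not in the domain. By duality it amounts to a hidden regularity
(`exists_integral_bvel_le`): the boundary stresses of a trajectory are square integrable in time,
with a bound by the norm of its state. This comes from the multiplier `x ∂ₓ`.

Necessity: the transposition identity tests only adjoint states whose three traces at `L` vanish at
time `τ`, so `τ = T` alone misses a space of dimension three. For `τ < T` the defect of the identity
is a linear functional that vanishes on the common kernel of the three traces at time `τ`, hence a
combination of them. On the orbits that pass through `bⱼ` at time `T`, the traces are `(τ - T) δᵢⱼ +
o(τ - T)`, while the defect is `o(τ - T)` because `U` reaches zero in the graph norm. So the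
coefficients tend to zero and the defect vanishes in the limit on every orbit
(`tendsto_zero_of_ker_le`). As the pairing with `U τ` also tends to zero, the moment identity is
what remains. -/

noncomputable section

namespace LaminatedBeam

/-! ### Skew operators and approximations of their inverses -/

section SkewGroup

variable {H : Type*} [NormedAddCommGroup H] [InnerProductSpace ℝ H] [CompleteSpace H]

/-- A vector `x` orthogonal to the range is tested against `R (R x)`: skewness gives `‖R x‖² = 0`.
-/
theorem denseRange_of_skew {R : H →L[ℝ] H} (hR : ∀ x y, inner ℝ (R x) y = -inner ℝ x (R y))
    (hinj : Function.Injective R) : DenseRange R := by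
  have h : (R.range : Submodule ℝ H)ᗮ = ⊥ := by
    rw [Submodule.eq_bot_iff]
    intro x hx
    refine hinj ?_
    rw [map_zero]
    have := hx (R (R x)) ⟨R x, rfl⟩
    rw [hR] at this
    simpa using this
  have h2 := (Submodule.topologicalClosure_eq_top_iff (K := (R.range : Submodule ℝ H))).2 h
  intro x
  have : x ∈ ((R.range : Submodule ℝ H)).topologicalClosure := by rw [h2]; trivial
  exact this

/-- Lax–Milgram for `δ - R²`: skewness gives `⟪-R² x, x⟫ = ‖R x‖²`, so `δ` is a coercivity constant,
and the norm bound follows from it as well. -/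
theorem exists_inverse_sub_sq {R : H →L[ℝ] H}
    (hR : ∀ x y, inner ℝ (R x) y = -inner ℝ x (R y)) {δ : ℝ} (hδ : 0 < δ) :
    ∃ M : H →L[ℝ] H, (∀ x, δ • M x - R (R (M x)) = x) ∧ (∀ x, R (M x) = M (R x)) ∧
      ∀ x, ‖δ • M x‖ ≤ ‖x‖ := by
  let Q : H →L[ℝ] H := δ • ContinuousLinearMap.id ℝ H - R ∘L R
  have hQ : ∀ x, Q x = δ • x - R (R x) := fun x => rfl
  have hin : ∀ x, δ * ‖x‖ ^ 2 ≤ inner ℝ (Q x) x := by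
    intro x
    rw [hQ, inner_sub_left, hR (R x) x, inner_smul_left, real_inner_self_eq_norm_sq,
      real_inner_self_eq_norm_sq]
    simp only [conj_trivial]
    nlinarith [sq_nonneg ‖R x‖]
  have hco : IsCoercive (innerSL ℝ ∘L Q) := by
    refine ⟨δ, hδ, fun x => ?_⟩
    have h1 : (innerSL ℝ ∘L Q) x x = inner ℝ (Q x) x := rfl
    have := hin x
    rw [h1]
    linarith
  have hinner : ∀ x y, inner ℝ (hco.continuousLinearEquivOfBilin x) y = inner ℝ (Q x) y := by
    intro x y
    rw [hco.continuousLinearEquivOfBilin_apply]; rfl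
  have hEq : ∀ x, hco.continuousLinearEquivOfBilin x = Q x := fun x =>
    ext_inner_right ℝ (hinner x)
  let M : H →L[ℝ] H := hco.continuousLinearEquivOfBilin.symm
  have hM1 : ∀ x, Q (M x) = x := by
    intro x; rw [← hEq]; exact hco.continuousLinearEquivOfBilin.apply_symm_apply x
  have hM2 : ∀ x, M (Q x) = x := by
    intro x; rw [← hEq]; exact hco.continuousLinearEquivOfBilin.symm_apply_apply x
  refine ⟨M, fun x => hM1 x, fun x => ?_, fun x => ?_⟩
  · have : Q (R (M x)) = R x := by
      conv_rhs => rw [← hM1 x]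
      simp [hQ]
    rw [← this, hM2]
  · have h1 := hin (M x)
    rw [hM1] at h1
    have h2 := real_inner_le_norm x (M x)
    rw [norm_smul, Real.norm_of_nonneg hδ.le]
    rcases (norm_nonneg (M x)).eq_or_lt with h | h
    · rw [← h]; simp
    · nlinarith

theorem norm_exp_smul_apply {A : H →L[ℝ] H} (hA : ∀ x, inner ℝ (A x) x = 0) (t : ℝ) (x : H) :
    ‖NormedSpace.exp (t • A) x‖ = ‖x‖ := by
  have hd : ∀ s : ℝ, HasDerivAt (fun s : ℝ => NormedSpace.exp (s • A) x)
      (A (NormedSpace.exp (s • A) x)) s := by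
    intro s
    have := (hasDerivAt_exp_smul_const' (𝕂 := ℝ) A s).clm_apply (hasDerivAt_const s x)
    simpa using this
  have h2 : ∀ s : ℝ, HasDerivAt (fun s : ℝ => ‖NormedSpace.exp (s • A) x‖ ^ 2) 0 s := by
    intro s
    have := (hd s).norm_sq
    rwa [real_inner_comm, hA, mul_zero] at this
  have h3 := is_const_of_deriv_eq_zero (fun s => (h2 s).differentiableAt)
    (fun s => (h2 s).deriv) t 0
  simp only [zero_smul, NormedSpace.exp_zero, one_apply_eq_self] at h3
  exact (sq_eq_sq₀ (norm_nonneg _) (norm_nonneg _)).1 h3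

theorem norm_exp_smul_apply_sub_le {A : H →L[ℝ] H} (hA : ∀ x, inner ℝ (A x) x = 0) (t : ℝ)
    (x : H) : ‖NormedSpace.exp (t • A) x - x‖ ≤ ‖A x‖ * |t| := by
  have hd : ∀ s : ℝ, HasDerivAt (fun s : ℝ => NormedSpace.exp (s • A) x)
      (NormedSpace.exp (s • A) (A x)) s := by
    intro s
    have := (hasDerivAt_exp_smul_const (𝕂 := ℝ) A s).clm_apply (hasDerivAt_const s x)
    simpa using this
  have := convex_univ.norm_image_sub_le_of_norm_hasDerivWithin_le (x := (0:ℝ)) (y := t)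
    (f := fun s : ℝ => NormedSpace.exp (s • A) x) (C := ‖A x‖)
    (fun s _ => (hd s).hasDerivWithinAt) (fun s _ => (norm_exp_smul_apply hA s _).le)
    (mem_univ _) (mem_univ _)
  simpa using this

theorem tendsto_of_dense_of_bounded {E : ℕ → H →L[ℝ] H} (hb : ∀ n x, ‖E n x‖ ≤ ‖x‖)
    {s : Set H} (hs : Dense s) (h : ∀ x ∈ s, ∃ y, Tendsto (fun n => E n x) atTop (𝓝 y)) (x : H) :
    ∃ y, Tendsto (fun n => E n x) atTop (𝓝 y) := by
  refine cauchySeq_tendsto_of_complete ?_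
  rw [Metric.cauchySeq_iff']
  intro ε hε
  obtain ⟨y, hy, hxy⟩ := hs.exists_dist_lt x (show (0 : ℝ) < ε / 3 by positivity)
  obtain ⟨z, hz⟩ := h y hy
  obtain ⟨N, hN⟩ := Metric.cauchySeq_iff'.1 hz.cauchySeq (ε / 3) (by positivity)
  refine ⟨N, fun n hn => ?_⟩
  have h1 : ∀ n, dist (E n x) (E n y) < ε / 3 := by
    intro n
    rw [dist_eq_norm, ← map_sub]
    exact (hb n _).trans_lt (by rwa [← dist_eq_norm])
  have h2 := h1 N
  rw [dist_comm] at h2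
  linarith [dist_triangle4 (E n x) (E n y) (E N y) (E N x), h1 n, hN n hn]

/-- The operators `-R (δ - R²)⁻¹` with `δ = 1 / (n + 1)` are bounded, skew and formally tend to
`R⁻¹`. On `R³ y` the error is `δ` times a vector of norm at most `2 ‖y‖`, by the relation `R² M = δ
M - 1` for `M = (δ - R²)⁻¹`. -/
theorem exists_skew_approximation {R : H →L[ℝ] H}
    (hR : ∀ x y, inner ℝ (R x) y = -inner ℝ x (R y)) :
    ∃ A : ℕ → H →L[ℝ] H, (∀ n x, inner ℝ (A n x) x = 0) ∧ (∀ n m, Commute (A n) (A m)) ∧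
      (∀ n x, A n (R x) = R (A n x)) ∧
      ∀ n y, ‖A n (R (R (R y))) - R (R y)‖ ≤ 2 * ‖y‖ * (1 / ((n : ℝ) + 1)) := by
  have hδ : ∀ n : ℕ, (0 : ℝ) < 1 / ((n : ℝ) + 1) := fun n => by positivity
  choose M hM1 hM2 hM3 using fun n => exists_inverse_sub_sq hR (hδ n)
  have hM4 : ∀ n x, M n ((1 / ((n : ℝ) + 1)) • x - R (R x)) = x := by
    intro n x
    rw [map_sub, map_smul, ← hM2, ← hM2, hM1]
  have hMM : ∀ n m x, M n (M m x) = M m (M n x) := by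
    intro n m x
    rw [← hM4 m (M n (M m x)), hM2, hM2, ← map_smul, ← map_sub, hM1]
  refine ⟨fun n => -(R ∘L M n), fun n x => ?_, fun n m => ?_, fun n x => ?_, fun n y => ?_⟩
  · have h1 : ∀ z, inner ℝ (R z) z = 0 := by
      intro z
      have := hR z z
      rw [real_inner_comm] at this
      rw [real_inner_comm]
      linarith
    have h2 := hM1 n x
    calc inner ℝ ((-(R ∘L M n)) x) x = -inner ℝ (R (M n x)) x := by simp
      _ = -inner ℝ (R (M n x)) ((1 / ((n : ℝ) + 1)) • M n x - R (R (M n x))) := by rw [h2]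
      _ = 0 := by
        rw [inner_sub_right, inner_smul_right, h1, real_inner_comm, h1]; simp
  · ext x
    simp only [ContinuousLinearMap.mul_def, ContinuousLinearMap.comp_apply,
      neg_apply, map_neg, neg_neg]
    simp only [hM2, hMM n m]
  · simp only [ContinuousLinearMap.comp_apply, neg_apply, map_neg, hM2]
  · set d := 1 / ((n : ℝ) + 1)
    have h1 := hM1 n y
    have h2 : (-(R ∘L M n)) (R (R (R y))) - R (R y) = -(d • (d • M n y - y)) := by
      have h3 : R (R (M n y)) = d • M n y - y := 
        eq_sub_of_add_eq (by rw [add_comm]; exact (sub_eq_iff_eq_add.1 h1).symm)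
      have h4 : R (R (R (R (M n y)))) = d • (d • M n y - y) - R (R y) := by
        rw [h3, map_sub, map_sub, map_smul, map_smul, h3]
      simp only [ContinuousLinearMap.comp_apply, neg_apply, ← hM2, h4]
      abel
    rw [h2, norm_neg, norm_smul, Real.norm_of_nonneg (hδ n).le]
    have h5 := (norm_sub_le (d • M n y) y).trans (add_le_add_left (hM3 n y) _)
    nlinarith [hδ n, norm_nonneg y]

end SkewGroup
end LaminatedBeam
end

noncomputable section

namespace LaminatedBeam

/-! ### The isometric group as a limit of exponentials -/

section SkewGroup

variable {H : Type*} [NormedAddCommGroup H] [InnerProductSpace ℝ H] [CompleteSpace H]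

theorem exp_smul_add (A : H →L[ℝ] H) (s t : ℝ) :
    NormedSpace.exp ((s + t) • A) = NormedSpace.exp (s • A) * NormedSpace.exp (t • A) := by
  let : NormedAlgebra ℚ (H →L[ℝ] H) := NormedAlgebra.restrictScalars ℚ ℝ _
  rw [add_smul, NormedSpace.exp_add_of_commute]
  exact ((Commute.refl A).smul_left s).smul_right t

/-- Commutation gives `exp (tA) = exp (tB) exp (t(A - B))`, where the first factor is an isometry
and the second is generated by the skew operator `A - B`. -/
theorem norm_exp_smul_sub_exp_smul_le {A B : H →L[ℝ] H} (hA : ∀ x, inner ℝ (A x) x = 0)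
    (hB : ∀ x, inner ℝ (B x) x = 0) (hAB : Commute A B) (t : ℝ) (x : H) :
    ‖NormedSpace.exp (t • A) x - NormedSpace.exp (t • B) x‖ ≤ ‖A x - B x‖ * |t| := by
  let : NormedAlgebra ℚ (H →L[ℝ] H) := NormedAlgebra.restrictScalars ℚ ℝ _
  have h1 : NormedSpace.exp (t • A) = NormedSpace.exp (t • B) * NormedSpace.exp (t • (A - B)) := by
    rw [← NormedSpace.exp_add_of_commute]
    · congr 1; module
    · exact (((hAB.symm.sub_right (Commute.refl B))).smul_left t).smul_right t
  have h2 : ∀ x, inner ℝ ((A - B) x) x = 0 := by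
    intro x
    rw [sub_apply, inner_sub_left, hA, hB, sub_zero]
  rw [h1, mul_apply_eq_comp, ← map_sub, norm_exp_smul_apply hB]
  exact norm_exp_smul_apply_sub_le h2 t x

theorem norm_exp_smul_sub_le {A : H →L[ℝ] H} (hA : ∀ x, inner ℝ (A x) x = 0) (s t : ℝ) (x : H) :
    ‖NormedSpace.exp (s • A) x - NormedSpace.exp (t • A) x‖ ≤ ‖A x‖ * |s - t| := by
  have h : s = t + (s - t) := by ring
  conv_lhs => rw [h]
  rw [exp_smul_add, mul_apply_eq_comp, ← map_sub, norm_exp_smul_apply hA]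
  exact norm_exp_smul_apply_sub_le hA _ x

theorem continuous_exp_smul_apply (A : H →L[ℝ] H) (x : H) :
    Continuous fun t : ℝ => NormedSpace.exp (t • A) x := by
  let : NormedAlgebra ℚ (H →L[ℝ] H) := NormedAlgebra.restrictScalars ℚ ℝ _
  have h : Continuous fun t : ℝ => NormedSpace.exp (t • A) :=
    NormedSpace.exp_continuous.comp (continuous_id.smul continuous_const)
  exact h.clm_apply continuous_const

theorem integral_exp_smul (A : H →L[ℝ] H) (x : H) (t : ℝ) :
    ∫ r in (0 : ℝ)..t, NormedSpace.exp (r • A) (A x) = NormedSpace.exp (t • A) x - x := by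
  have hd : ∀ s : ℝ, HasDerivAt (fun s : ℝ => NormedSpace.exp (s • A) x)
      (NormedSpace.exp (s • A) (A x)) s := by
    intro s
    have := (hasDerivAt_exp_smul_const (𝕂 := ℝ) A s).clm_apply (hasDerivAt_const s x)
    simpa using this
  rw [intervalIntegral.integral_eq_sub_of_hasDerivAt (fun s _ => hd s)
    ((continuous_exp_smul_apply A (A x)).intervalIntegrable _ _)]
  simp

/-- Stone's theorem, phrased through the inverse of the generator so that only bounded operators
occur. The exponentials of the approximate generators are isometries, so convergence is needed only
on the dense range of `R³`, where these generators converge. -/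
theorem exists_isometric_group {R : H →L[ℝ] H}
    (hR : ∀ x y, inner ℝ (R x) y = -inner ℝ x (R y)) (hinj : Function.Injective R) :
    ∃ S : ℝ → H →L[ℝ] H, (∀ x, S 0 x = x) ∧ (∀ s t x, S (s + t) x = S s (S t x)) ∧
      (∀ t x, ‖S t x‖ = ‖x‖) ∧ (∀ x, Continuous fun t => S t x) ∧
      (∀ t x, R (S t x) = S t (R x)) ∧
      ∀ t x, R (S t x - x) = ∫ r in (0 : ℝ)..t, S r x := by
  obtain ⟨A, hA, hAc, hAR, hAb⟩ := exists_skew_approximation hR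
  have hdR := denseRange_of_skew hR hinj
  have hdense : Dense (range fun y => R (R (R y))) :=
    hdR.comp (hdR.comp hdR R.continuous) R.continuous
  have hzero : Tendsto (fun n : ℕ => 1 / ((n : ℝ) + 1)) atTop (𝓝 0) :=
    tendsto_one_div_add_atTop_nhds_zero_nat
  have hAlim : ∀ y, Tendsto (fun n => A n (R (R (R y)))) atTop (𝓝 (R (R y))) := by
    intro y
    rw [tendsto_iff_norm_sub_tendsto_zero]
    refine squeeze_zero (fun n => norm_nonneg _) (fun n => hAb n y) ?_
    simpa using hzero.const_mul (2 * ‖y‖)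
  have hlim : ∀ (t : ℝ) (x : H), ∃ z, Tendsto (fun n => NormedSpace.exp (t • A n) x) atTop (𝓝 z) := by
    intro t
    refine tendsto_of_dense_of_bounded (fun n x => (norm_exp_smul_apply (hA n) t x).le) hdense ?_
    rintro _ ⟨y, rfl⟩
    refine cauchySeq_tendsto_of_complete ?_
    have hc := (hAlim y).cauchySeq
    rw [Metric.cauchySeq_iff] at hc ⊢
    intro ε hε
    obtain ⟨N, hN⟩ := hc (ε / (|t| + 1)) (by positivity)
    refine ⟨N, fun m hm n hn => ?_⟩
    have h1 := hN m hm n hn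
    rw [dist_eq_norm] at h1 ⊢
    have h2 := norm_exp_smul_sub_exp_smul_le (hA m) (hA n) (hAc m n) t (R (R (R y)))
    rw [lt_div_iff₀ (by positivity)] at h1
    nlinarith [norm_nonneg (A m (R (R (R y))) - A n (R (R (R y)))), abs_nonneg t]
  choose S₀ hS₀ using hlim
  let S : ℝ → H →L[ℝ] H := fun t =>
    continuousLinearMapOfTendsto (fun n => NormedSpace.exp (t • A n))
      (f := S₀ t) (tendsto_pi_nhds.2 fun x => hS₀ t x)
  have hS : ∀ (t : ℝ) (x : H), Tendsto (fun n => NormedSpace.exp (t • A n) x) atTop (𝓝 (S t x)) := hS₀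
  have hnorm : ∀ t x, ‖S t x‖ = ‖x‖ := by
    intro t x
    refine tendsto_nhds_unique (hS t x).norm ?_
    simp only [norm_exp_smul_apply (hA _)]
    exact tendsto_const_nhds
  have hlip : ∀ y s t, ‖S s (R (R (R y))) - S t (R (R (R y)))‖ ≤ ‖R (R y)‖ * |s - t| := by
    intro y s t
    exact le_of_tendsto_of_tendsto' ((hS s _).sub (hS t _)).norm
      ((hAlim y).norm.mul_const _) (fun n => norm_exp_smul_sub_le (hA n) s t _)
  have hcont : ∀ x, Continuous fun t => S t x := by
    intro x
    refine continuous_of_uniform_approx_of_continuous fun u hu => ?_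
    obtain ⟨ε, hε, hεu⟩ := Metric.mem_uniformity_dist.1 hu
    obtain ⟨_, ⟨y, rfl⟩, hxy⟩ := hdense.exists_dist_lt x hε
    refine ⟨fun t => S t (R (R (R y))), ?_, fun t => hεu ?_⟩
    · refine (LipschitzWith.of_dist_le_mul (K := ‖R (R y)‖₊) fun s t => ?_).continuous
      rw [dist_eq_norm, Real.dist_eq]
      exact hlip y s t
    · rw [dist_eq_norm, ← map_sub, hnorm, ← dist_eq_norm]
      exact hxy
  have hcomm : ∀ t x, R (S t x) = S t (R x) := by
    intro t x
    refine tendsto_nhds_unique ((R.continuous.tendsto _).comp (hS t x)) ?_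
    refine (hS t (R x)).congr fun n => ?_
    let : NormedAlgebra ℚ (H →L[ℝ] H) := NormedAlgebra.restrictScalars ℚ ℝ _
    have h1 : Commute R (t • A n) := by
      refine Commute.smul_right ?_ t
      ext x
      exact (hAR n x).symm
    have h2 := h1.exp_right
    exact (congrArg (fun B : H →L[ℝ] H => B x) h2.eq).symm
  have hgroup : ∀ s t x, S (s + t) x = S s (S t x) := by
    intro s t x
    refine tendsto_nhds_unique (hS (s + t) x) ?_
    rw [tendsto_iff_norm_sub_tendsto_zero]
    have h1 : Tendsto (fun n => ‖NormedSpace.exp (t • A n) x - S t x‖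
        + ‖NormedSpace.exp (s • A n) (S t x) - S s (S t x)‖) atTop (𝓝 0) := by
      have := (tendsto_iff_norm_sub_tendsto_zero.1 (hS t x)).add
        (tendsto_iff_norm_sub_tendsto_zero.1 (hS s (S t x)))
      simpa using this
    refine squeeze_zero (fun n => norm_nonneg _) (fun n => ?_) h1
    rw [exp_smul_add, mul_apply_eq_comp,
      ← norm_exp_smul_apply (hA n) s (NormedSpace.exp (t • A n) x - S t x), map_sub]
    exact norm_sub_le_norm_sub_add_norm_sub _ _ _
  refine ⟨S, fun x => ?_, hgroup, hnorm, hcont, hcomm, fun t x => ?_⟩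
  · refine tendsto_nhds_unique (hS 0 x) ?_
    simp
  -- Both sides are continuous in `x`, so the mild equation is needed only on the dense range of
  -- `R²`. There it is the limit of `integral_exp_smul` for the approximations, applied to `R³ y`.
  · have hint : Continuous fun x => ∫ r in (0 : ℝ)..t, S r x := by
      refine (LipschitzWith.of_dist_le_mul (K := ‖t‖₊) fun x y => ?_).continuous
      rw [dist_eq_norm, dist_eq_norm, ← intervalIntegral.integral_sub
        ((hcont x).intervalIntegrable _ _) ((hcont y).intervalIntegrable _ _)]
      have := intervalIntegral.norm_integral_le_of_norm_le_const (a := 0) (b := t)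
        (f := fun r => S r x - S r y) (C := ‖x - y‖)
        (fun r _ => by rw [← map_sub, hnorm])
      simpa [mul_comm] using this
    have hleft : Continuous fun x => R (S t x - x) := by fun_prop
    refine congrFun (hleft.ext_on (hdR.comp (hdR) R.continuous) hint ?_) x
    rintro _ ⟨y, rfl⟩
    change R (S t (R (R y)) - R (R y)) = ∫ r in (0 : ℝ)..t, S r (R (R y))
    have h1 : Tendsto (fun n => ∫ r in (0 : ℝ)..t, NormedSpace.exp (r • A n) (A n (R (R (R y)))))
        atTop (𝓝 (∫ r in (0 : ℝ)..t, S r (R (R y)))) := by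
      obtain ⟨C, hC⟩ := (hAlim y).norm.bddAbove_range
      refine intervalIntegral.tendsto_integral_filter_of_dominated_convergence (fun _ => C)
        (Eventually.of_forall fun n => (continuous_exp_smul_apply _ _).aestronglyMeasurable)
        (Eventually.of_forall fun n => Eventually.of_forall fun r _ => ?_)
        intervalIntegrable_const (Eventually.of_forall fun r _ => ?_)
      · rw [norm_exp_smul_apply (hA n)]
        exact hC ⟨n, rfl⟩
      · have h2 : Tendsto (fun n => NormedSpace.exp (r • A n) (A n (R (R (R y))) - R (R y)))
            atTop (𝓝 0) := by
          refine tendsto_zero_iff_norm_tendsto_zero.2 ?_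
          simp only [norm_exp_smul_apply (hA _)]
          exact tendsto_iff_norm_sub_tendsto_zero.1 (hAlim y)
        have h3 := h2.add (hS r (R (R y)))
        simpa using h3
    refine tendsto_nhds_unique ?_ h1
    simp only [integral_exp_smul]
    have h4 : R (S t (R (R y)) - R (R y)) = S t (R (R (R y))) - R (R (R y)) := by
      rw [map_sub, hcomm]
    rw [h4]
    exact (hS t _).sub_const _

end SkewGroup
end LaminatedBeam
end

noncomputable section

namespace LaminatedBeam

/-! ### Coercive forms, representation and uniqueness -/

section Form

universe v

/-- A copy of a normed space, with its algebraic and topological structure but no norm. -/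
def TopCopy (X : Type v) : Type v := X

instance (X : Type v) [NormedAddCommGroup X] : AddCommGroup (TopCopy X) :=
  inferInstanceAs (AddCommGroup X)

instance (X : Type v) [NormedAddCommGroup X] [NormedSpace ℝ X] : Module ℝ (TopCopy X) :=
  inferInstanceAs (Module ℝ X)

instance (X : Type v) [NormedAddCommGroup X] : TopologicalSpace (TopCopy X) :=
  inferInstanceAs (TopologicalSpace X)

instance (X : Type v) [NormedAddCommGroup X] : IsTopologicalAddGroup (TopCopy X) :=
  inferInstanceAs (IsTopologicalAddGroup X)

instance (X : Type v) [NormedAddCommGroup X] [NormedSpace ℝ X] :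
    ContinuousConstSMul ℝ (TopCopy X) :=
  inferInstanceAs (ContinuousConstSMul ℝ X)

/-- The identity, from a normed space to its copy. -/
def toTopCopy (X : Type v) [NormedAddCommGroup X] [NormedSpace ℝ X] : X ≃L[ℝ] TopCopy X :=
  ContinuousLinearEquiv.refl ℝ X

theorem completeSpace_of_continuousLinearEquiv {X Y : Type*} [NormedAddCommGroup X]
    [NormedSpace ℝ X] [CompleteSpace X] [NormedAddCommGroup Y] [NormedSpace ℝ Y]
    (Φ : X ≃L[ℝ] Y) : CompleteSpace Y :=
  (completeSpace_congr (e := Φ.toEquiv) Φ.isUniformEmbedding).1 inferInstance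

variable {X : Type v} [NormedAddCommGroup X] [NormedSpace ℝ X] [CompleteSpace X]

/-- A symmetric coercive bounded bilinear form turns a Banach space into a Hilbert space. -/
theorem exists_hilbert_of_isCoercive (e : X →L[ℝ] X →L[ℝ] ℝ) (hs : ∀ x y, e x y = e y x)
    (hc : IsCoercive e) :
    ∃ (H : Type v) (_ : NormedAddCommGroup H) (_ : InnerProductSpace ℝ H) (_ : CompleteSpace H)
      (Φ : X ≃L[ℝ] H), ∀ x y, inner ℝ (Φ x) (Φ y) = e x y := by
  obtain ⟨C, hC, hCe⟩ := hc
  let cd : InnerProductSpace.Core ℝ (TopCopy X) :=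
    { inner := fun x y => e ((toTopCopy X).symm x) ((toTopCopy X).symm y)
      conj_inner_symm := fun x y => by simp [hs ((toTopCopy X).symm x)]
      re_inner_nonneg := fun x => by
        have := hCe ((toTopCopy X).symm x)
        simp only [RCLike.re_to_real]
        exact le_trans (by positivity) this
      add_left := fun x y z => by simp
      smul_left := fun x y r => by simp
      definite := fun x hx => by
        have h1 := hCe ((toTopCopy X).symm x)
        change e ((toTopCopy X).symm x) ((toTopCopy X).symm x) = 0 at hx
        rw [hx] at h1
        have h2 : ‖(toTopCopy X).symm x‖ * ‖(toTopCopy X).symm x‖ ≤ 0 := by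
          by_contra! h
          nlinarith
        exact (map_eq_zero_iff _ (toTopCopy X).symm.injective).1 <| norm_eq_zero.1 (mul_self_eq_zero.1 (le_antisymm h2 (mul_self_nonneg _))) }
  have h : ContinuousAt (fun v : TopCopy X => cd.inner v v) 0 := by
    change ContinuousAt (fun v : TopCopy X => e ((toTopCopy X).symm v) ((toTopCopy X).symm v)) 0
    fun_prop
  have h' : Bornology.IsVonNBounded ℝ {v : TopCopy X | RCLike.re (cd.inner v v) < 1} := by
    have h2 : Bornology.IsVonNBounded ℝ {v : X | e v v < 1} := by
      rw [NormedSpace.isVonNBounded_iff, isBounded_iff_forall_norm_le]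
      refine ⟨1 + 1 / C, fun v hv => ?_⟩
      have h1 : e v v < 1 := hv
      have h2 := hCe v
      by_contra! h3
      have h4 : 1 / C < ‖v‖ := by linarith
      have h5 : 1 < ‖v‖ := by linarith [show 0 < 1 / C by positivity]
      rw [div_lt_iff₀ hC] at h4
      nlinarith
    exact h2
  let i1 : NormedAddCommGroup (TopCopy X) := cd.toNormedAddCommGroupOfTopology h h'
  let i2 : InnerProductSpace ℝ (TopCopy X) := InnerProductSpace.ofCoreOfTopology cd h h'
  exact ⟨TopCopy X, i1, i2, completeSpace_of_continuousLinearEquiv (toTopCopy X), toTopCopy X,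
    fun x y => rfl⟩

/-- Riesz representation in the Hilbert space defined by the form. -/
theorem exists_forall_eq_of_isCoercive {e : X →L[ℝ] X →L[ℝ] ℝ} (hs : ∀ x y, e x y = e y x)
    (hc : IsCoercive e) (ℓ : X →L[ℝ] ℝ) : ∃ x, ∀ y, e x y = ℓ y := by
  obtain ⟨H, _, _, _, Φ, hΦ⟩ := exists_hilbert_of_isCoercive e hs hc
  refine ⟨Φ.symm ((InnerProductSpace.toDual ℝ H).symm (ℓ ∘L (Φ.symm : H →L[ℝ] X))), fun y => ?_⟩
  rw [← hΦ, Φ.apply_symm_apply, InnerProductSpace.toDual_symm_apply]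
  simp

theorem eq_of_forall_form_eq {e : X →L[ℝ] X →L[ℝ] ℝ} (hc : IsCoercive e) {x y : X}
    (h : ∀ z, e x z = e y z) : x = y := by
  obtain ⟨C, hC, hCe⟩ := hc
  have h1 := hCe (x - y)
  rw [map_sub e, sub_apply, h, sub_self] at h1
  have h2 : ‖x - y‖ * ‖x - y‖ ≤ 0 := by
    by_contra! h
    nlinarith
  exact sub_eq_zero.1 (norm_eq_zero.1 (mul_self_eq_zero.1 (le_antisymm h2 (mul_self_nonneg _))))

/-- The operator that represents a bounded bilinear form `ω` in terms of a coercive one. -/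
theorem exists_operator_of_isCoercive {e : X →L[ℝ] X →L[ℝ] ℝ} (hs : ∀ x y, e x y = e y x)
    (hc : IsCoercive e) (ω : X →L[ℝ] X →L[ℝ] ℝ) : ∃ R : X →L[ℝ] X, ∀ x y, e (R x) y = -ω x y := by
  choose R hR using fun x => exists_forall_eq_of_isCoercive hs hc (-ω x)
  obtain ⟨C, hC, hCe⟩ := id hc
  refine ⟨LinearMap.mkContinuous ⟨⟨R, fun x y => ?_⟩, fun c x => ?_⟩ (‖ω‖ / C) fun x => ?_,
    fun x y => hR x y⟩
  · exact eq_of_forall_form_eq hc fun z => by simp [hR, add_comm]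
  · exact eq_of_forall_form_eq hc fun z => by simp [hR]
  · change ‖R x‖ ≤ _
    have h1 := hCe (R x)
    rw [hR] at h1
    have h2 := (neg_le_abs _).trans (ω.le_opNorm₂ x (R x))
    rw [neg_apply] at h1
    rw [div_mul_eq_mul_div, le_div_iff₀ hC]
    rcases (norm_nonneg (R x)).eq_or_lt with h | h
    · rw [← h]; simpa using by positivity
    · nlinarith

/-- The group generated by the inverse of a skew operator. -/
theorem exists_group_of_isCoercive {e : X →L[ℝ] X →L[ℝ] ℝ} (hs : ∀ x y, e x y = e y x)
    (hc : IsCoercive e) {R : X →L[ℝ] X} (hR : ∀ x y, e (R x) y = -e x (R y))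
    (hinj : Function.Injective R) :
    ∃ S : ℝ → X →L[ℝ] X, (∀ x, S 0 x = x) ∧ (∀ s t x, S (s + t) x = S s (S t x)) ∧
      (∀ t x y, e (S t x) (S t y) = e x y) ∧ (∀ x, Continuous fun t => S t x) ∧
      (∀ t x, R (S t x) = S t (R x)) ∧
      ∀ t x, R (S t x - x) = ∫ r in (0 : ℝ)..t, S r x := by
  obtain ⟨H, _, _, _, Φ, hΦ⟩ := exists_hilbert_of_isCoercive e hs hc
  let R' : H →L[ℝ] H := (Φ : X →L[ℝ] H) ∘L R ∘L (Φ.symm : H →L[ℝ] X)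
  have hR' : ∀ x, R' x = Φ (R (Φ.symm x)) := fun x => rfl
  obtain ⟨S, h0, hadd, hnorm, hcont, hcomm, hint⟩ := exists_isometric_group (R := R')
    (fun x y => by
      obtain ⟨x, rfl⟩ := Φ.surjective x
      obtain ⟨y, rfl⟩ := Φ.surjective y
      simp only [hR', Φ.symm_apply_apply, hΦ, hR])
    (Φ.injective.comp (hinj.comp Φ.symm.injective))
  have hinner : ∀ t x y, inner ℝ (S t x) (S t y) = (inner ℝ x y : ℝ) := by
    intro t x y
    rw [real_inner_eq_norm_add_mul_self_sub_norm_mul_self_sub_norm_mul_self_div_two,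
      real_inner_eq_norm_add_mul_self_sub_norm_mul_self_sub_norm_mul_self_div_two,
      ← map_add, hnorm, hnorm, hnorm]
  refine ⟨fun t => (Φ.symm : H →L[ℝ] X) ∘L S t ∘L (Φ : X →L[ℝ] H), fun x => ?_, fun s t x => ?_,
    fun t x y => ?_, fun x => ?_, fun t x => ?_, fun t x => ?_⟩
  · simp [h0]
  · simp [hadd]
  · rw [← hΦ, ← hΦ]
    simp [hinner]
  · exact Φ.symm.continuous.comp (hcont _)
  · have := hcomm t (Φ x)
    rw [hR', hR'] at this
    apply Φ.injective
    simpa using this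
  · have h1 := hint t (Φ x)
    apply Φ.injective
    rw [hR', map_sub, Φ.symm_apply_apply] at h1
    simp only [ContinuousLinearMap.comp_apply, ContinuousLinearEquiv.coe_coe] at h1 ⊢
    have h2 := (Φ.symm : H →L[ℝ] X).intervalIntegral_comp_comm (μ := volume)
      ((hcont (Φ x)).intervalIntegrable 0 t)
    simp only [ContinuousLinearEquiv.coe_coe] at h2
    rw [h1, h2, Φ.apply_symm_apply]

/-- A vector on which the inverse of `R` is bounded in the weak sense belongs to the range. -/
theorem exists_preimage_of_forall_le {e : X →L[ℝ] X →L[ℝ] ℝ} (hs : ∀ x y, e x y = e y x)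
    (hc : IsCoercive e) {R : X →L[ℝ] X} (hR : ∀ x y, e (R x) y = -e x (R y))
    (hinj : Function.Injective R) :
    ∃ K : ℝ, 0 ≤ K ∧ ∀ (C : ℝ) (x : X), 0 ≤ C → (∀ y, |e x y| ≤ C * ‖R y‖) →
      ∃ z, R z = x ∧ ‖z‖ ≤ K * C := by
  obtain ⟨c, hcpos, hce⟩ := id hc
  refine ⟨1 / c, by positivity, fun C x hC hx => ?_⟩
  let ι := LinearEquiv.ofInjective (R : X →ₗ[ℝ] X) hinj
  have hι : ∀ w, ((ι (ι.symm w) : LinearMap.range (R : X →ₗ[ℝ] X)) : X) = R (ι.symm w) :=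
    fun w => rfl
  -- The functional `R y ↦ e x y` is well defined by injectivity and bounded by hypothesis. It is
  -- extended by Hahn–Banach with the same norm and represented by the form; the minus sign below
  -- compensates the skewness of `R`.
  let f : StrongDual ℝ (LinearMap.range (R : X →ₗ[ℝ] X)) :=
    LinearMap.mkContinuous ((e x : X →ₗ[ℝ] ℝ) ∘ₗ ι.symm.toLinearMap) C fun w => by
      have h1 := hx (ι.symm w)
      rw [← hι, ι.apply_symm_apply] at h1
      exact h1
  obtain ⟨g, hg, hgn⟩ := exists_extension_norm_eq _ f
  have hgC : ‖g‖ ≤ C := hgn ▸ LinearMap.mkContinuous_norm_le _ hC _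
  obtain ⟨z, hz⟩ := exists_forall_eq_of_isCoercive hs hc (-g)
  refine ⟨z, eq_of_forall_form_eq hc fun y => ?_, ?_⟩
  · have h2 := hg (ι y)
    have h3 : f (ι y) = e x y := by
      change e x (ι.symm (ι y)) = _
      rw [ι.symm_apply_apply]
    have h4 : ((ι y : LinearMap.range (R : X →ₗ[ℝ] X)) : X) = R y := rfl
    rw [hR, hz, ← h3, ← h2, h4]
    simp
  · have h1 := hce z
    rw [hz] at h1
    have h2 := (le_abs_self _).trans ((-g).le_opNorm z)
    rw [norm_neg] at h2
    rw [one_div, inv_mul_eq_div, le_div_iff₀ hcpos]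
    rcases (norm_nonneg z).eq_or_lt with h | h
    · rw [← h]; simpa using hC
    · nlinarith

theorem exists_norm_le_of_form_eq {e : X →L[ℝ] X →L[ℝ] ℝ} (hc : IsCoercive e) :
    ∃ C : ℝ, 0 < C ∧ ∀ x y, e x x = e y y → ‖x‖ ≤ C * ‖y‖ := by
  obtain ⟨c, hc, hce⟩ := hc
  refine ⟨√((‖e‖ + 1) / c), by positivity, fun x y hxy => ?_⟩
  refine abs_le_of_sq_le_sq' ?_ (by positivity) |>.2
  rw [mul_pow, Real.sq_sqrt (by positivity), div_mul_eq_mul_div, le_div_iff₀ hc]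
  have h1 := hce x
  rw [hxy] at h1
  have h2 := (le_abs_self _).trans (e.le_opNorm₂ y y)
  nlinarith [sq_nonneg ‖y‖]

theorem eq_zero_of_form_eq_zero {e : X →L[ℝ] X →L[ℝ] ℝ} (hc : IsCoercive e) {x : X}
    (h : e x x = 0) : x = 0 := by
  obtain ⟨C, -, hC⟩ := exists_norm_le_of_form_eq hc
  have := hC x 0 (by rw [h, map_zero])
  rwa [norm_zero, mul_zero, norm_le_zero_iff] at this

/-- Uniqueness of mild solutions. -/
theorem eq_zero_of_eq_integral {e : X →L[ℝ] X →L[ℝ] ℝ} (hs : ∀ x y, e x y = e y x)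
    (hc : IsCoercive e) {R : X →L[ℝ] X} (hR : ∀ x y, e (R x) y = -e x (R y))
    (hinj : Function.Injective R) {τ : ℝ} {D : ℝ → X} (hD : ContinuousOn D (Icc 0 τ))
    (hDR : ∀ t ∈ Icc 0 τ, R (D t) = ∫ r in τ..t, D r) {t : ℝ} (ht : t ∈ Icc 0 τ) : D t = 0 := by
  have hτ : 0 ≤ τ := ht.1.trans ht.2
  -- Clamping time to `[0, τ]` extends `D` continuously to the line, so that its primitive `Y` is
  -- differentiable everywhere.
  let c : ℝ → ℝ := fun t => max 0 (min t τ)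
  have hc1 : ∀ t, c t ∈ Icc 0 τ := fun t => ⟨le_max_left _ _, max_le hτ (min_le_right _ _)⟩
  have hc2 : ∀ t ∈ Icc 0 τ, c t = t := fun t ht => by
    change max 0 (min t τ) = t
    rw [min_eq_left ht.2, max_eq_right ht.1]
  have hcont : Continuous (D ∘ c) :=
    hD.comp_continuous (continuous_const.max (continuous_id.min continuous_const)) hc1
  let Y : ℝ → X := fun t => ∫ r in τ..t, (D ∘ c) r
  have hY : ∀ t, HasDerivAt Y ((D ∘ c) t) t := fun t =>
    (hcont.integral_hasStrictDerivAt τ t).hasDerivAt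
  have hYR : ∀ t ∈ Icc 0 τ, Y t = R (D t) := by
    intro t ht
    rw [hDR t ht]
    refine intervalIntegral.integral_congr fun r hr => ?_
    rw [uIcc_of_ge ht.2] at hr
    simp only [Function.comp_apply, hc2 r ⟨ht.1.trans hr.1, hr.2⟩]
  -- On `[0, τ]` the primitive is `Y = R D`, so the derivative of its energy is `2 e(D, R D) = 0`;
  -- and `Y` vanishes at `τ`.
  have hE : ∀ t ∈ Icc 0 τ, e (Y t) (Y t) = e (Y 0) (Y 0) := by
    refine constant_of_has_deriv_right_zero ?_ fun t ht => ?_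
    · have : Continuous Y := continuous_iff_continuousAt.2 fun t => (hY t).continuousAt
      exact ((e.continuous.comp this).clm_apply this).continuousOn
    · have h1 := (e.hasFDerivAt.comp_hasDerivAt t (hY t)).clm_apply (hY t)
      have h2 := Ico_subset_Icc_self ht
      have h3 : e (D t) (R (D t)) = 0 := by
        have := hR (D t) (D t)
        rw [hs] at this
        linarith
      refine (h1.congr_deriv ?_).hasDerivWithinAt
      simp only [Function.comp_apply, hc2 t h2, hYR t h2]
      rw [hs (R (D t)), h3, add_zero]
  have hYτ : Y τ = 0 := intervalIntegral.integral_same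
  have hYt : Y t = 0 := by
    refine eq_zero_of_form_eq_zero hc ?_
    rw [hE t ht, ← hE τ (right_mem_Icc.2 hτ), hYτ, map_zero]
  rw [hYR t ht] at hYt
  exact hinj (by rw [hYt, map_zero])

end Form
end LaminatedBeam
end

noncomputable section

namespace LaminatedBeam

/-! ### Sobolev functions on an interval -/

section Sobolev

variable {L : ℝ}

theorem intervalIntegrable_coe (hL : 0 ≤ L) (g : L2 L) :
    IntervalIntegrable (fun y => g y) volume 0 L := by
  have h : Integrable (fun y => g y) (volume.restrict (Ioo (0 : ℝ) L)) :=
    (Lp.memLp g).integrable (by norm_num)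
  rw [intervalIntegrable_iff_integrableOn_Ioo_of_le hL]
  exact h

theorem inner_eq_intervalIntegral (hL : 0 ≤ L) (f g : L2 L) :
    inner ℝ f g = ∫ x in (0 : ℝ)..L, f x * g x := by
  rw [L2.inner_def, intervalIntegral.integral_of_le hL, integral_Ioc_eq_integral_Ioo]
  refine integral_congr_ae (Eventually.of_forall fun x => ?_)
  simp [mul_comm]

theorem intervalIntegral_congr_Ioo (hL : 0 ≤ L) {f g : ℝ → ℝ}
    (h : ∀ᵐ x ∂(volume.restrict (Ioo (0 : ℝ) L)), f x = g x) :
    ∫ x in (0 : ℝ)..L, f x = ∫ x in (0 : ℝ)..L, g x := by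
  rw [intervalIntegral.integral_of_le hL, integral_Ioc_eq_integral_Ioo,
    intervalIntegral.integral_of_le hL, integral_Ioc_eq_integral_Ioo]
  exact integral_congr_ae h

theorem absolutelyContinuous_primitive (hL : 0 ≤ L) (c : ℝ) (g : L2 L) :
    AbsolutelyContinuousOnInterval (fun x => c + ∫ y in (0 : ℝ)..x, g y) 0 L := by
  have h1 := (intervalIntegrable_coe hL g).absolutelyContinuousOnInterval_intervalIntegral
    (c := 0) left_mem_uIcc
  have h2 : AbsolutelyContinuousOnInterval (fun _ : ℝ => c) 0 L :=
    ((LipschitzWith.const c).lipschitzOnWith (s := uIcc 0 L)).absolutelyContinuousOnInterval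
  exact h2.add h1

theorem ae_hasDerivAt_primitive (hL : 0 ≤ L) (c : ℝ) (g : L2 L) :
    ∀ᵐ x ∂(volume.restrict (Ioo (0 : ℝ) L)),
      HasDerivAt (fun x => c + ∫ y in (0 : ℝ)..x, g y) (g x) x := by
  rw [ae_restrict_iff' measurableSet_Ioo]
  filter_upwards [(intervalIntegrable_coe hL g).ae_hasDerivAt_integral] with x hx hx2
  exact (hx (by rw [uIcc_of_le hL]; exact Ioo_subset_Icc_self hx2) 0 left_mem_uIcc).const_add c

/-- Integration by parts for the absolutely continuous representatives. -/
theorem IsH1.inner_add_inner (hL : 0 ≤ L) {f f' g g' : L2 L} {a A b B : ℝ}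
    (hf : IsH1 L f f' a A) (hg : IsH1 L g g' b B) :
    inner ℝ f' g + inner ℝ f g' = A * B - a * b := by
  have h := (absolutelyContinuous_primitive hL a f').integral_mul_deriv_eq_deriv_mul
    (absolutelyContinuous_primitive hL b g')
  rw [← hf.2, ← hg.2, intervalIntegral.integral_same, intervalIntegral.integral_same, add_zero,
    add_zero] at h
  have h1 : inner ℝ f g' = ∫ x in (0 : ℝ)..L, (a + ∫ y in (0 : ℝ)..x, f' y) *
      deriv (fun x => b + ∫ y in (0 : ℝ)..x, g' y) x := by
    rw [inner_eq_intervalIntegral hL]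
    refine intervalIntegral_congr_Ioo hL ?_
    filter_upwards [hf.1, ae_hasDerivAt_primitive hL b g'] with x hx hx2
    rw [hx2.deriv, hx]
  have h2 : inner ℝ f' g = ∫ x in (0 : ℝ)..L, deriv (fun x => a + ∫ y in (0 : ℝ)..x, f' y) x *
      (b + ∫ y in (0 : ℝ)..x, g' y) := by
    rw [inner_eq_intervalIntegral hL]
    refine intervalIntegral_congr_Ioo hL ?_
    filter_upwards [hg.1, ae_hasDerivAt_primitive hL a f'] with x hx hx2
    rw [hx2.deriv, hx]
  rw [h1, h2, h]
  ring

theorem exists_isH1 (hL : 0 ≤ L) (c : ℝ) (g : L2 L) :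
    ∃ f : L2 L, IsH1 L f g c (c + ∫ y in (0 : ℝ)..L, g y) := by
  have h1 : ContinuousOn (fun x => c + ∫ y in (0 : ℝ)..x, g y) (uIcc 0 L) :=
    (absolutelyContinuous_primitive hL c g).continuousOn
  rw [uIcc_of_le hL] at h1
  have h2 : MemLp (fun x => c + ∫ y in (0 : ℝ)..x, g y) 2 (volume.restrict (Ioo (0 : ℝ) L)) := by
    obtain ⟨C, hC⟩ := isCompact_Icc.exists_bound_of_continuousOn h1
    refine MemLp.of_bound ((h1.mono Ioo_subset_Icc_self).aestronglyMeasurable measurableSet_Ioo) C ?_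
    filter_upwards [ae_restrict_mem measurableSet_Ioo] with x hx
    exact hC x (Ioo_subset_Icc_self hx)
  exact ⟨h2.toLp _, h2.coeFn_toLp, rfl⟩

theorem exists_dx_eq (hL : 0 ≤ L) (g : L2 L) : ∃ w : H1Star L, dx w = g := by
  obtain ⟨f, hf⟩ := exists_isH1 hL 0 g
  exact ⟨⟨(f, g), _, hf⟩, rfl⟩

theorem isH1_of_H1Star (w : H1Star L) : IsH1 L (fn w) (dx w) 0 (atL w) := by
  obtain ⟨c, hc⟩ := w.2
  refine ⟨hc.1, ?_⟩
  rw [zero_add]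
  rfl

/-- The two primitives agree almost everywhere, hence by continuity on the open interval, and so do
their derivatives wherever both exist. -/
theorem IsH1.eq_of_ae (hL : 0 ≤ L) {f f' g' : L2 L} {a A b B : ℝ} (hf : IsH1 L f f' a A)
    (hg : IsH1 L f g' b B) : f' = g' := by
  refine Lp.ext ?_
  have h1 : ∀ᵐ x ∂(volume.restrict (Ioo (0 : ℝ) L)),
      a + ∫ y in (0 : ℝ)..x, f' y = b + ∫ y in (0 : ℝ)..x, g' y := by
    filter_upwards [hf.1, hg.1] with x h1 h2
    rw [← h1, h2]
  have c1 := (absolutelyContinuous_primitive hL a f').continuousOn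
  have c2 := (absolutelyContinuous_primitive hL b g').continuousOn
  rw [uIcc_of_le hL] at c1 c2
  have h2 := Measure.eqOn_open_of_ae_eq h1 isOpen_Ioo (c1.mono Ioo_subset_Icc_self)
    (c2.mono Ioo_subset_Icc_self)
  filter_upwards [ae_hasDerivAt_primitive hL a f', ae_hasDerivAt_primitive hL b g',
    ae_restrict_mem measurableSet_Ioo] with x h3 h4 hx
  refine h3.unique (h4.congr_of_eventuallyEq ?_)
  filter_upwards [Ioo_mem_nhds hx.1 hx.2] with y hy
  exact h2 hy

theorem fn_injective (hL : 0 ≤ L) : Function.Injective (fn (L := L)) := by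
  intro w v h
  have h1 := isH1_of_H1Star w
  rw [h] at h1
  exact Subtype.ext (Prod.ext h (h1.eq_of_ae hL (isH1_of_H1Star v)))

theorem dx_injective : Function.Injective (dx (L := L)) := by
  intro w v h
  refine Subtype.ext (Prod.ext (Lp.ext ?_) h)
  have h1 := (isH1_of_H1Star w).1
  rw [h] at h1
  filter_upwards [h1, (isH1_of_H1Star v).1] with x h1 h2
  exact h1.trans h2.symm

/-- Weak characterisation of `H¹` functions with a given derivative and a given value at `L`. -/
theorem exists_isH1_iff (hL : 0 ≤ L) (f g : L2 L) (A : ℝ) :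
    (∃ c, IsH1 L f g c A) ↔
      ∀ w : H1Star L, inner ℝ f (dx w) = A * atL w - inner ℝ g (fn w) := by
  constructor
  · rintro ⟨c, hc⟩ w
    have := hc.inner_add_inner hL (isH1_of_H1Star w)
    linarith
  · intro h
    -- As `dx` is onto `L²`, the hypothesis determines `f`; the primitive of `g` with value `A` at
    -- `L` satisfies the same identity.
    obtain ⟨f₁, hf₁⟩ := exists_isH1 hL (A - ∫ y in (0 : ℝ)..L, g y) g
    rw [sub_add_cancel] at hf₁
    have h1 : f = f₁ := by
      refine ext_inner_right ℝ fun v => ?_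
      obtain ⟨w, rfl⟩ := exists_dx_eq hL v
      have := hf₁.inner_add_inner hL (isH1_of_H1Star w)
      rw [h w]
      linarith
    exact ⟨_, h1 ▸ hf₁⟩

/-- Multiplication by `x` on `L²(0, L)`. -/
theorem exists_mul_id (L : ℝ) : ∃ X : L2 L →L[ℝ] L2 L,
    (∀ f : L2 L, ∀ᵐ x ∂(volume.restrict (Ioo (0 : ℝ) L)), X f x = x * f x) ∧
      ∀ f g : L2 L, inner ℝ (X f) g = (inner ℝ f (X g) : ℝ) := by
  have h : MemLp (fun x : ℝ => x) ⊤ (volume.restrict (Ioo (0 : ℝ) L)) := by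
    refine memLp_top_of_bound (by fun_prop) |L| ?_
    filter_upwards [ae_restrict_mem measurableSet_Ioo] with x hx
    rw [Real.norm_of_nonneg hx.1.le]
    exact hx.2.le.trans (le_abs_self _)
  let X := (ContinuousLinearMap.mul ℝ ℝ).holderL (volume.restrict (Ioo (0 : ℝ) L)) ⊤ 2 2 (h.toLp _)
  have hX : ∀ f : L2 L, ∀ᵐ x ∂(volume.restrict (Ioo (0 : ℝ) L)), X f x = x * f x := by
    intro f
    filter_upwards [(ContinuousLinearMap.mul ℝ ℝ).coeFn_holder (r := 2) (h.toLp _) f,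
      h.coeFn_toLp] with x h1 h2
    rw [h2] at h1
    exact h1
  refine ⟨X, hX, fun f g => ?_⟩
  rw [L2.inner_def, L2.inner_def]
  refine integral_congr_ae ?_
  filter_upwards [hX f, hX g] with x h1 h2
  simp only [h1, h2, RCLike.inner_apply, conj_trivial]
  ring

/-- The integral of `(x f²)' = f² + 2 x f f'` is `L A²`; the factor `x` removes the value at `0`. -/
theorem inner_mul_id {X : L2 L →L[ℝ] L2 L} (hL : 0 ≤ L)
    (hX : ∀ f : L2 L, ∀ᵐ x ∂(volume.restrict (Ioo (0 : ℝ) L)), X f x = x * f x)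
    {f f' : L2 L} {a A : ℝ}
    (hf : IsH1 L f f' a A) : 2 * inner ℝ (X f') f = L * A ^ 2 - inner ℝ f f := by
  have hF := absolutelyContinuous_primitive hL a f'
  have hid : AbsolutelyContinuousOnInterval (fun x : ℝ => x) 0 L :=
    (LipschitzWith.id.lipschitzOnWith (s := uIcc 0 L)).absolutelyContinuousOnInterval
  have h1 := (hid.fun_mul (hF.fun_mul hF)).integral_deriv_eq_sub
  simp only [← hf.2, zero_mul, sub_zero] at h1
  have h2 : inner ℝ (f + (2 : ℝ) • X f') f = ∫ x in (0 : ℝ)..L,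
      deriv (fun x => x * ((a + ∫ y in (0 : ℝ)..x, f' y) * (a + ∫ y in (0 : ℝ)..x, f' y))) x := by
    rw [inner_eq_intervalIntegral hL]
    refine intervalIntegral_congr_Ioo hL ?_
    filter_upwards [hf.1, ae_hasDerivAt_primitive hL a f', hX f', Lp.coeFn_add f ((2 : ℝ) • X f'),
      Lp.coeFn_smul (2 : ℝ) (X f')] with x h3 h4 h5 h6 h7
    rw [((hasDerivAt_id' x).fun_mul (h4.fun_mul h4)).deriv, h6, Pi.add_apply, h7, Pi.smul_apply, h5, ← h3,
      smul_eq_mul]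
    ring
  rw [inner_add_left, inner_smul_left, h1] at h2
  simp only [conj_trivial] at h2
  linarith

end Sobolev
end LaminatedBeam
end

noncomputable section

namespace LaminatedBeam

/-! ### The energy form and the symplectic form -/

section Forms

variable {L : ℝ}

/-- `fn` as a bounded operator. -/
def fnCLM (L : ℝ) : H1Star L →L[ℝ] L2 L :=
  (ContinuousLinearMap.fst ℝ (L2 L) (L2 L)).comp (H1Star L).subtypeL

/-- `dx` as a bounded operator. -/
def dxCLM (L : ℝ) : H1Star L →L[ℝ] L2 L :=
  (ContinuousLinearMap.snd ℝ (L2 L) (L2 L)).comp (H1Star L).subtypeL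

theorem exists_atL_eq (L : ℝ) (hL : 0 ≤ L) : ∃ A : H1Star L →L[ℝ] ℝ, ∀ w, A w = atL w := by
  let c : L2 L := indicatorConstLp 2 (μ := volume.restrict (Ioo (0 : ℝ) L))
    MeasurableSet.univ (measure_ne_top _ _) (1 : ℝ)
  refine ⟨innerSL ℝ c ∘L dxCLM L, fun w => ?_⟩
  change inner ℝ c (dx w) = _
  rw [L2.inner_indicatorConstLp_one, Measure.restrict_univ, atL,
    intervalIntegral.integral_of_le hL, integral_Ioc_eq_integral_Ioo]

/-- Poincaré's inequality from the open mapping theorem: `dx` is a bounded bijection between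
complete spaces. -/
theorem exists_norm_le_dx (hL : 0 ≤ L) : ∃ K : ℝ, 0 < K ∧ ∀ w : H1Star L, ‖w‖ ≤ K * ‖dx w‖ := by
  have h1 : (dxCLM L : H1Star L →ₗ[ℝ] L2 L).ker = ⊥ :=
    LinearMap.ker_eq_bot.2 dx_injective
  have h2 : (dxCLM L : H1Star L →ₗ[ℝ] L2 L).range = ⊤ :=
    LinearMap.range_eq_top.2 (exists_dx_eq hL)
  let E := ContinuousLinearEquiv.ofBijective (dxCLM L) h1 h2
  refine ⟨‖(E.symm : L2 L →L[ℝ] H1Star L)‖ + 1, by positivity, fun w => ?_⟩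
  have h3 := (E.symm : L2 L →L[ℝ] H1Star L).le_opNorm (E w)
  rw [ContinuousLinearEquiv.coe_coe, E.symm_apply_apply] at h3
  have h4 : E w = dx w := rfl
  rw [h4] at h3
  nlinarith [norm_nonneg (dx w)]

/-- Evaluation at `L` as a bounded functional (zero for a degenerate interval). -/
def atLCLM (L : ℝ) : H1Star L →L[ℝ] ℝ :=
  if hL : 0 ≤ L then (exists_atL_eq L hL).choose else 0

theorem atLCLM_apply (hL : 0 ≤ L) (w : H1Star L) : atLCLM L w = atL w := by
  rw [atLCLM, dif_pos hL]
  exact (exists_atL_eq L hL).choose_spec w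

/-- The position components as bounded operators. -/
def posC (L : ℝ) (i : Fin 3) : Phase L →L[ℝ] H1Star L :=
  (ContinuousLinearMap.proj i).comp (ContinuousLinearMap.fst ℝ _ _)

/-- The velocity components as bounded operators. -/
def velC (L : ℝ) (i : Fin 3) : Phase L →L[ℝ] L2 L :=
  (ContinuousLinearMap.proj i).comp
    ((ContinuousLinearMap.fst ℝ _ _).comp (ContinuousLinearMap.snd ℝ _ _))

/-- The boundary velocity components as bounded functionals. -/
def bvelC (L : ℝ) (i : Fin 3) : Phase L →L[ℝ] ℝ :=
  (ContinuousLinearMap.proj i).comp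
    ((ContinuousLinearMap.snd ℝ _ _).comp (ContinuousLinearMap.snd ℝ _ _))

/-- The shear `w_x + ξ + s`. -/
def shearC (L : ℝ) : Phase L →L[ℝ] L2 L :=
  dxCLM L ∘L posC L 0 + fnCLM L ∘L posC L 1 + fnCLM L ∘L posC L 2

@[simp] theorem posC_apply (i : Fin 3) (U : Phase L) : posC L i U = U.pos i := rfl

@[simp] theorem velC_apply (i : Fin 3) (U : Phase L) : velC L i U = U.vel i := rfl

@[simp] theorem bvelC_apply (i : Fin 3) (U : Phase L) : bvelC L i U = U.bvel i := rfl

@[simp] theorem fnCLM_apply (w : H1Star L) : fnCLM L w = fn w := rfl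

@[simp] theorem dxCLM_apply (w : H1Star L) : dxCLM L w = dx w := rfl

theorem shearC_apply (U : Phase L) :
    shearC L U = dx (U.pos 0) + fn (U.pos 1) + fn (U.pos 2) := rfl

/-- The bounded bilinear form `(U, V) ↦ ⟨A U, B V⟩`. -/
def innerForm {X E : Type*} [NormedAddCommGroup X] [NormedSpace ℝ X] [NormedAddCommGroup E]
    [InnerProductSpace ℝ E] (A B : X →L[ℝ] E) : X →L[ℝ] X →L[ℝ] ℝ :=
  (innerSL ℝ : E →L[ℝ] E →L[ℝ] ℝ).bilinearComp A B

@[simp] theorem innerForm_apply {X E : Type*} [NormedAddCommGroup X] [NormedSpace ℝ X]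
    [NormedAddCommGroup E] [InnerProductSpace ℝ E] (A B : X →L[ℝ] E) (x y : X) :
    innerForm A B x y = inner ℝ (A x) (B y) := rfl

/-- Finite sums of bounded bilinear forms. -/
def formSum {X : Type*} [NormedAddCommGroup X] [NormedSpace ℝ X]
    (B : Fin 3 → X →L[ℝ] X →L[ℝ] ℝ) : X →L[ℝ] X →L[ℝ] ℝ := ∑ i, B i

@[simp] theorem formSum_apply {X : Type*} [NormedAddCommGroup X] [NormedSpace ℝ X]
    (B : Fin 3 → X →L[ℝ] X →L[ℝ] ℝ) (x y : X) : formSum B x y = ∑ i, B i x y := by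
  simp [formSum, sum_apply]

/-- The energy form. -/
def energy (p : Params) : Phase p.L →L[ℝ] Phase p.L →L[ℝ] ℝ :=
  (3 * p.k) • innerForm (shearC p.L) (shearC p.L)
    + (3 * p.b) • innerForm (dxCLM p.L ∘L posC p.L 1) (dxCLM p.L ∘L posC p.L 1)
    + p.b • innerForm (dxCLM p.L ∘L posC p.L 2) (dxCLM p.L ∘L posC p.L 2)
    + p.γ • innerForm (fnCLM p.L ∘L posC p.L 2) (fnCLM p.L ∘L posC p.L 2)
    + formSum (fun i => p.mass i • innerForm (velC p.L i) (velC p.L i))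
    + formSum fun i => p.bweight i • innerForm (bvelC p.L i) (bvelC p.L i)

/-- The symplectic form, that is, the duality of the transposition method between states of the
phase space. -/
def symp (p : Params) : Phase p.L →L[ℝ] Phase p.L →L[ℝ] ℝ :=
  formSum fun i => (p.mass i • innerForm (velC p.L i) (fnCLM p.L ∘L posC p.L i)
    - p.mass i • innerForm (fnCLM p.L ∘L posC p.L i) (velC p.L i)
    - p.bweight i • innerForm (atLCLM p.L ∘L posC p.L i) (bvelC p.L i)
    + p.bweight i • innerForm (bvelC p.L i) (atLCLM p.L ∘L posC p.L i))

theorem energy_apply (p : Params) (U W : Phase p.L) : energy p U W =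
    3 * p.k * inner ℝ (shearC p.L U) (shearC p.L W)
      + 3 * p.b * inner ℝ (dx (U.pos 1)) (dx (W.pos 1))
      + p.b * inner ℝ (dx (U.pos 2)) (dx (W.pos 2))
      + p.γ * inner ℝ (fn (U.pos 2)) (fn (W.pos 2))
      + ∑ i, p.mass i * inner ℝ (U.vel i) (W.vel i)
      + ∑ i, p.bweight i * (U.bvel i * W.bvel i) := by
  simp [energy, mul_comm (Phase.bvel W _)]

theorem symp_apply (p : Params) (hL : 0 ≤ p.L) (U W : Phase p.L) : symp p U W =
    ∑ i, (p.mass i * inner ℝ (U.vel i) (fn (W.pos i)) - p.mass i * inner ℝ (fn (U.pos i)) (W.vel i)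
      - p.bweight i * (atL (U.pos i) * W.bvel i) + p.bweight i * (U.bvel i * atL (W.pos i))) := by
  simp [symp, atLCLM_apply hL, mul_comm]

theorem energy_comm (p : Params) (U W : Phase p.L) : energy p U W = energy p W U := by
  simp only [energy_apply, mul_comm, real_inner_comm]

theorem symp_neg (p : Params) (hL : 0 ≤ p.L) (U W : Phase p.L) : symp p U W = -symp p W U := by
  rw [symp_apply p hL, symp_apply p hL, ← Finset.sum_neg_distrib]
  refine Finset.sum_congr rfl fun i _ => ?_
  rw [real_inner_comm, real_inner_comm (fn (U.pos i))]
  ring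

/-- `boundaryPairing` supplies the terms with the boundary velocity of `U` that `pairing` lacks,
which makes the sum antisymmetric. -/
theorem symp_eq_pairing (p : Params) (hL : 0 ≤ p.L) (U W : Phase p.L) :
    symp p U W = pairing p U.toDual W + boundaryPairing p U.toDual W := by
  rw [symp_apply p hL, pairing, boundaryPairing, ← Finset.sum_add_distrib]
  refine Finset.sum_congr rfl fun i _ => ?_
  simp only [Phase.toDual]
  change _ = p.mass i * inner ℝ (U.vel i) (fn (W.pos i)) - _ - _ + _
  ring

theorem Params.mass_pos {p : Params} (hp : p.Positive) (i : Fin 3) : 0 < p.mass i := by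
  obtain ⟨h1, h2, -⟩ := hp
  fin_cases i <;> simp [Params.mass] <;> positivity

theorem Params.bweight_pos {p : Params} (hp : p.Positive) (i : Fin 3) : 0 < p.bweight i := by
  obtain ⟨-, -, h1, h2, -⟩ := hp
  fin_cases i <;> simp [Params.bweight] <;> positivity

end Forms
end LaminatedBeam
end

noncomputable section

namespace LaminatedBeam

/-! ### Variational description of the generator -/

section Generator

theorem shearC_mk (p : Params) (w : Fin 3 → H1Star p.L) (v : Fin 3 → L2 p.L) (c : Fin 3 → ℝ) :
    shearC p.L (w, v, c) = dx (w 0) + fn (w 1) + fn (w 2) := rfl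

/-- Testing with one component at a time gives the weak form of each equation, and `exists_isH1_iff`
turns it into `H¹` regularity. The shear is kept whole, as both the nondegeneracy of `symp` and the
multiplier argument use it in this form. -/
theorem exists_isH1_of_energy_eq {p : Params} (hp : p.Positive) {U F : Phase p.L}
    (h : ∀ W, energy p U W = -symp p F W) :
    (∀ i, fn (F.pos i) = U.vel i) ∧ (∀ i, U.bvel i = atL (F.pos i)) ∧
      (∃ c, IsH1 p.L (shearC p.L U) ((p.ρ₁ / p.k) • F.vel 0) c (-F.bvel 0)) ∧
      (∃ c, IsH1 p.L (dx (U.pos 1)) ((1 / p.b) • (p.ρ₂ • F.vel 1 + p.k • shearC p.L U)) c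
        (-F.bvel 1)) ∧
      ∃ c, IsH1 p.L (dx (U.pos 2)) ((1 / p.b) • (p.ρ₂ • F.vel 2 + (3 * p.k) • shearC p.L U
        + p.γ • fn (U.pos 2))) c (-F.bvel 2) := by
  obtain ⟨hρ₁, hρ₂, hk, hb, hγ, hL⟩ := id hp
  have hL' := hL.le
  have hm := Params.mass_pos hp
  have hw := Params.bweight_pos hp
  simp only [energy_apply, symp_apply p hL'] at h
  have hfn0 : fn (0 : H1Star p.L) = 0 := rfl
  have hdx0 : dx (0 : H1Star p.L) = 0 := rfl
  have hat0 : atL (0 : H1Star p.L) = 0 := by rw [← atLCLM_apply hL', map_zero]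
  have hvel : ∀ v : Fin 3 → L2 p.L, ∑ i, p.mass i * inner ℝ (U.vel i) (v i) =
      ∑ i, p.mass i * inner ℝ (fn (F.pos i)) (v i) := by
    intro v
    have h1 := h (0, v, 0)
    simpa [shearC_mk, Phase.pos, Phase.vel, Phase.bvel, hfn0, hdx0, hat0] using h1
  have hbvel : ∀ c : Fin 3 → ℝ, ∑ i, p.bweight i * (U.bvel i * c i) =
      ∑ i, p.bweight i * (atL (F.pos i) * c i) := by
    intro c
    have h1 := h (0, 0, c)
    simpa [shearC_mk, Phase.pos, Phase.vel, Phase.bvel, hfn0, hdx0, hat0] using h1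
  have hpos : ∀ w : Fin 3 → H1Star p.L,
      3 * p.k * inner ℝ (shearC p.L U) (dx (w 0) + fn (w 1) + fn (w 2))
      + 3 * p.b * inner ℝ (dx (U.pos 1)) (dx (w 1))
      + p.b * inner ℝ (dx (U.pos 2)) (dx (w 2))
      + p.γ * inner ℝ (fn (U.pos 2)) (fn (w 2)) =
      -∑ i, (p.mass i * inner ℝ (F.vel i) (fn (w i)) + p.bweight i * (F.bvel i * atL (w i))) := by
    intro w
    have h1 := h (w, 0, 0)
    simp only [shearC_mk, Phase.pos, Phase.vel, Phase.bvel, Pi.zero_apply] at h1 ⊢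
    simpa using h1
  have hvel' : ∀ i, fn (F.pos i) = U.vel i := by
    intro i
    refine ext_inner_right ℝ fun v => ?_
    have h1 := hvel (Pi.single i v)
    rw [Finset.sum_eq_single i (fun j _ hj => by simp [hj]) (by simp),
      Finset.sum_eq_single i (fun j _ hj => by simp [hj]) (by simp), Pi.single_eq_same] at h1
    exact (mul_left_cancel₀ (hm i).ne' h1).symm
  have hbvel' : ∀ i, U.bvel i = atL (F.pos i) := by
    intro i
    have h1 := hbvel (Pi.single i 1)
    rw [Finset.sum_eq_single i (fun j _ hj => by simp [hj]) (by simp),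
      Finset.sum_eq_single i (fun j _ hj => by simp [hj]) (by simp), Pi.single_eq_same, mul_one,
      mul_one] at h1
    exact mul_left_cancel₀ (hw i).ne' h1
  have e0 : ∀ w : H1Star p.L, inner ℝ (shearC p.L U) (dx w) =
      -F.bvel 0 * atL w - inner ℝ ((p.ρ₁ / p.k) • F.vel 0) (fn w) := by
    intro w
    have h1 := hpos (Pi.single 0 w)
    simp [Fin.sum_univ_three, hfn0, hdx0, hat0, Params.mass, Params.bweight] at h1
    rw [inner_smul_left, conj_trivial]
    field_simp
    linarith
  have e1 : ∀ w : H1Star p.L, inner ℝ (dx (U.pos 1)) (dx w) =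
      -F.bvel 1 * atL w
        - inner ℝ ((1 / p.b) • (p.ρ₂ • F.vel 1 + p.k • shearC p.L U)) (fn w) := by
    intro w
    have h1 := hpos (Pi.single 1 w)
    simp [Fin.sum_univ_three, hfn0, hdx0, hat0, Params.mass, Params.bweight] at h1
    simp only [inner_smul_left, inner_add_left, conj_trivial]
    field_simp
    linarith
  have e2 : ∀ w : H1Star p.L, inner ℝ (dx (U.pos 2)) (dx w) =
      -F.bvel 2 * atL w
        - inner ℝ ((1 / p.b) • (p.ρ₂ • F.vel 2 + (3 * p.k) • shearC p.L U
          + p.γ • fn (U.pos 2))) (fn w) := by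
    intro w
    have h1 := hpos (Pi.single 2 w)
    simp [Fin.sum_univ_three, hfn0, hdx0, hat0, Params.mass, Params.bweight] at h1
    simp only [inner_smul_left, inner_add_left, conj_trivial]
    field_simp
    linarith
  exact ⟨hvel', hbvel', (exists_isH1_iff hL' _ _ _).2 e0, (exists_isH1_iff hL' _ _ _).2 e1,
    (exists_isH1_iff hL' _ _ _).2 e2⟩

theorem isGen_of_energy_eq {p : Params} (hp : p.Positive) {U F : Phase p.L}
    (h : ∀ W, energy p U W = -symp p F W) : IsGen p U F := by
  obtain ⟨hρ₁, hρ₂, hk, hb, hγ, hL⟩ := id hp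
  have hL' := hL.le
  obtain ⟨hvel', hbvel', e0, ⟨c1, hc1⟩, c2, hc2⟩ := exists_isH1_of_energy_eq hp h
  replace e0 := (exists_isH1_iff hL' _ _ _).1 e0
  -- Integrating `ξ` and `s` by parts removes them from the shear and leaves the weak form for `w_x`
  -- alone.
  have e0' : ∀ w : H1Star p.L, inner ℝ (dx (U.pos 0)) (dx w) =
      (-F.bvel 0 - atL (U.pos 1) - atL (U.pos 2)) * atL w
        - inner ℝ ((p.ρ₁ / p.k) • F.vel 0 - dx (U.pos 1) - dx (U.pos 2)) (fn w) := by
    intro w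
    have h0 := e0 w
    have h1 := (isH1_of_H1Star (U.pos 1)).inner_add_inner hL' (isH1_of_H1Star w)
    have h2 := (isH1_of_H1Star (U.pos 2)).inner_add_inner hL' (isH1_of_H1Star w)
    rw [shearC_apply, inner_add_left, inner_add_left] at h0
    rw [inner_sub_left, inner_sub_left]
    linarith
  obtain ⟨c0, hc0⟩ := (exists_isH1_iff hL' _ _ _).2 e0'
  refine ⟨![(p.ρ₁ / p.k) • F.vel 0 - dx (U.pos 1) - dx (U.pos 2),
      (1 / p.b) • (p.ρ₂ • F.vel 1 + p.k • shearC p.L U),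
      (1 / p.b) • (p.ρ₂ • F.vel 2 + (3 * p.k) • shearC p.L U + p.γ • fn (U.pos 2))],
    ![c0, c1, c2], ![-F.bvel 0 - atL (U.pos 1) - atL (U.pos 2), -F.bvel 1, -F.bvel 2],
    fun i => ?_, hvel', hbvel', ?_, ?_, ?_, ?_, ?_, ?_⟩
  rotate_left
  · rw [Matrix.cons_val_zero, sub_sub, add_assoc, sub_add_cancel, smul_smul, smul_smul]
    rw [show 1 / p.ρ₁ * p.k * (p.ρ₁ / p.k) = 1 by field_simp, one_smul]
  · rw [Matrix.cons_val_one, Matrix.cons_val_zero, smul_smul,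
      show p.b * (1 / p.b) = 1 by field_simp, one_smul, ← shearC_apply, add_sub_cancel_right,
      smul_smul, show 1 / p.ρ₂ * p.ρ₂ = 1 by field_simp, one_smul]
  · rw [Matrix.cons_val_two, Matrix.tail_cons, Matrix.head_cons, smul_smul,
      show p.b * (1 / p.b) = 1 by field_simp, one_smul, ← shearC_apply, add_sub_right_comm,
      add_sub_cancel_right, add_sub_cancel_right, smul_smul,
      show 1 / p.ρ₂ * p.ρ₂ = 1 by field_simp, one_smul]
  · rw [Matrix.cons_val_zero]; ring
  · simp
  · simp
  · fin_cases i
    · exact hc0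
    · exact hc1
    · exact hc2

theorem energy_eq_of_isGen {p : Params} (hp : p.Positive) {U F : Phase p.L}
    (h : IsGen p U F) (W : Phase p.L) : energy p U W = -symp p F W := by
  obtain ⟨hρ₁, hρ₂, hk, hb, hγ, hL⟩ := id hp
  have hL' := hL.le
  obtain ⟨dd, d₀, dL, hdd, hvel, hbvel, v0, v1, v2, b0, b1, b2⟩ := h
  have e : ∀ i (w : H1Star p.L), _ := fun i => (exists_isH1_iff hL' _ _ _).1 ⟨_, hdd i⟩
  have g : ∀ i, _ := fun i =>
    (isH1_of_H1Star (U.pos i)).inner_add_inner hL' (isH1_of_H1Star (W.pos 0))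
  have q0 := e 0 (W.pos 0)
  have q1 := e 1 (W.pos 1)
  have q2 := e 2 (W.pos 2)
  have g1 := g 1
  have g2 := g 2
  rw [energy_apply, symp_apply p hL', Fin.sum_univ_three, Fin.sum_univ_three, Fin.sum_univ_three]
  simp only [hvel, hbvel, v0, v1, v2, b0, b1, b2, Params.mass, Params.bweight,
    Matrix.cons_val_zero, Matrix.cons_val_one, Matrix.cons_val_two, Matrix.tail_cons,
    Matrix.head_cons, ← shearC_apply, inner_smul_left, inner_sub_left,
    inner_add_left, conj_trivial]
  rw [shearC_apply W]
  have q : inner ℝ (shearC p.L U) (dx (W.pos 0)) = (dL 0 + atL (U.pos 1) + atL (U.pos 2))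
      * atL (W.pos 0) - (inner ℝ (dd 0) (fn (W.pos 0)) + inner ℝ (dx (U.pos 1)) (fn (W.pos 0))
        + inner ℝ (dx (U.pos 2)) (fn (W.pos 0))) := by
    rw [shearC_apply, inner_add_left, inner_add_left]
    linarith
  simp only [inner_add_right, q, q1, q2]
  field_simp
  ring

theorem isGen_iff_energy {p : Params} (hp : p.Positive) {U F : Phase p.L} :
    IsGen p U F ↔ ∀ W, energy p U W = -symp p F W :=
  ⟨energy_eq_of_isGen hp, isGen_of_energy_eq hp⟩

/-- Poincaré bounds `ξ` and `s` by their derivatives, and then `w_x` is the shear minus `ξ + s`. The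
phase space carries the supremum norm of its components, so each of them is bounded separately by
the root of the energy. -/
theorem isCoercive_energy {p : Params} (hp : p.Positive) : IsCoercive (energy p) := by
  obtain ⟨hρ₁, hρ₂, hk, hb, hγ, hL⟩ := id hp
  have hm := Params.mass_pos hp
  have hw := Params.bweight_pos hp
  obtain ⟨P, hP, hPd⟩ := exists_norm_le_dx hL.le
  have key : ∃ K : ℝ, 0 < K ∧ ∀ U : Phase p.L, ‖U‖ ≤ K * √(energy p U U) := by
    have hterm : ∀ U : Phase p.L, 0 ≤ energy p U U ∧
        3 * p.k * ‖shearC p.L U‖ ^ 2 ≤ energy p U U ∧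
        3 * p.b * ‖dx (U.pos 1)‖ ^ 2 ≤ energy p U U ∧ p.b * ‖dx (U.pos 2)‖ ^ 2 ≤ energy p U U ∧
        (∀ i, p.mass i * ‖U.vel i‖ ^ 2 ≤ energy p U U) ∧
        ∀ i, p.bweight i * ‖U.bvel i‖ ^ 2 ≤ energy p U U := by
      intro U
      have h1 : ∀ i, 0 ≤ p.mass i * ‖U.vel i‖ ^ 2 := fun i => by have := hm i; positivity
      have h2 : ∀ i, 0 ≤ p.bweight i * ‖U.bvel i‖ ^ 2 := fun i => by have := hw i; positivity
      have h3 := fun i => Finset.single_le_sum (fun j _ => h1 j) (Finset.mem_univ i)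
      have h4 := fun i => Finset.single_le_sum (fun j _ => h2 j) (Finset.mem_univ i)
      have h5 := Finset.sum_nonneg fun i (_ : i ∈ Finset.univ) => h1 i
      have h6 := Finset.sum_nonneg fun i (_ : i ∈ Finset.univ) => h2 i
      have h7 : energy p U U = 3 * p.k * ‖shearC p.L U‖ ^ 2 + 3 * p.b * ‖dx (U.pos 1)‖ ^ 2
          + p.b * ‖dx (U.pos 2)‖ ^ 2 + p.γ * ‖fn (U.pos 2)‖ ^ 2
          + ∑ i, p.mass i * ‖U.vel i‖ ^ 2 + ∑ i, p.bweight i * ‖U.bvel i‖ ^ 2 := by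
        rw [energy_apply]
        simp only [real_inner_self_eq_norm_sq, Real.norm_eq_abs, sq_abs, ← sq]
      have h8 : 0 ≤ 3 * p.k * ‖shearC p.L U‖ ^ 2 := by positivity
      have h9 : 0 ≤ 3 * p.b * ‖dx (U.pos 1)‖ ^ 2 := by positivity
      have h10 : 0 ≤ p.b * ‖dx (U.pos 2)‖ ^ 2 := by positivity
      have h11 : 0 ≤ p.γ * ‖fn (U.pos 2)‖ ^ 2 := by positivity
      rw [h7]
      refine ⟨by linarith, by linarith, by linarith, by linarith, fun i => ?_, fun i => ?_⟩
      · linarith [h3 i]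
      · linarith [h4 i]
    have hsq : ∀ c : ℝ, 0 < c → ∃ K : ℝ, 0 < K ∧ ∀ a E : ℝ, 0 ≤ E → c * a ^ 2 ≤ E →
        a ≤ K * √E := by
      intro c hc
      refine ⟨√(1 / c), by positivity, fun a E hE h => ?_⟩
      rw [← Real.sqrt_mul (by positivity)]
      refine Real.le_sqrt_of_sq_le ?_
      rw [one_div_mul_eq_div, le_div_iff₀ hc]
      linarith
    obtain ⟨K1, hK1, k1⟩ := hsq (3 * p.k) (by positivity)
    obtain ⟨K2, hK2, k2⟩ := hsq (3 * p.b) (by positivity)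
    obtain ⟨K3, hK3, k3⟩ := hsq p.b hb
    choose K4 hK4 k4 using fun i => hsq (p.mass i) (hm i)
    choose K5 hK5 k5 using fun i => hsq (p.bweight i) (hw i)
    have s4 := fun i => Finset.single_le_sum (fun j _ => (hK4 j).le) (Finset.mem_univ i)
    have s5 := fun i => Finset.single_le_sum (fun j _ => (hK5 j).le) (Finset.mem_univ i)
    set Q0 := P * (K1 + P * K2 + P * K3)
    have hQ0 : 0 < Q0 := by positivity
    have h4s := Finset.sum_nonneg fun i (_ : i ∈ Finset.univ) => (hK4 i).le
    have h5s := Finset.sum_nonneg fun i (_ : i ∈ Finset.univ) => (hK5 i).le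
    have hQ2 : 0 < P * K2 := by positivity
    have hQ3 : 0 < P * K3 := by positivity
    refine ⟨Q0 + P * K2 + P * K3 + ∑ i, K4 i + ∑ i, K5 i, by positivity, fun U => ?_⟩
    obtain ⟨hE, a1, a2, a3, a4, a5⟩ := hterm U
    set r := √(energy p U U)
    have hr : 0 ≤ r := Real.sqrt_nonneg _
    have b1 := k1 _ _ hE a1
    have b2 := k2 _ _ hE a2
    have b3 := k3 _ _ hE a3
    have c2 : ‖U.pos 1‖ ≤ P * K2 * r := by
      have := hPd (U.pos 1)
      nlinarith
    have c3 : ‖U.pos 2‖ ≤ P * K3 * r := by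
      have := hPd (U.pos 2)
      nlinarith
    have hfn : ∀ w : H1Star p.L, ‖fn w‖ ≤ ‖w‖ := fun w => norm_fst_le (w : L2 p.L × L2 p.L)
    have c1 : ‖U.pos 0‖ ≤ Q0 * r := by
      have h1 := hPd (U.pos 0)
      have h2 : dx (U.pos 0) = shearC p.L U - fn (U.pos 1) - fn (U.pos 2) := by
        rw [shearC_apply]; abel
      have h3 : ‖dx (U.pos 0)‖ ≤ ‖shearC p.L U‖ + ‖fn (U.pos 1)‖ + ‖fn (U.pos 2)‖ := by
        rw [h2]
        exact (norm_sub_le _ _).trans (add_le_add_left (norm_sub_le _ _) _)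
      have h4 := hfn (U.pos 1)
      have h5 := hfn (U.pos 2)
      calc ‖U.pos 0‖ ≤ P * ‖dx (U.pos 0)‖ := h1
        _ ≤ P * (K1 * r + P * K2 * r + P * K3 * r) := by gcongr; linarith
        _ = Q0 * r := by ring
    have hbig : ∀ c a : ℝ, a ≤ c * r → c ≤ Q0 + P * K2 + P * K3 + ∑ i, K4 i + ∑ i, K5 i →
        a ≤ (Q0 + P * K2 + P * K3 + ∑ i, K4 i + ∑ i, K5 i) * r := fun c a h1 h2 =>
      h1.trans (mul_le_mul_of_nonneg_right h2 hr)
    have hnn : 0 ≤ (Q0 + P * K2 + P * K3 + ∑ i, K4 i + ∑ i, K5 i) * r := by positivity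
    rw [Prod.norm_def, Prod.norm_def]
    refine max_le ((pi_norm_le_iff_of_nonneg hnn).2 fun i => ?_)
      (max_le ((pi_norm_le_iff_of_nonneg hnn).2 fun i => ?_)
        ((pi_norm_le_iff_of_nonneg hnn).2 fun i => ?_))
    · fin_cases i
      · exact hbig _ _ c1 (by linarith)
      · exact hbig _ _ c2 (by linarith)
      · exact hbig _ _ c3 (by linarith)
    · exact hbig _ _ (k4 i _ _ hE (a4 i)) (by linarith [s4 i])
    · exact hbig _ _ (k5 i _ _ hE (a5 i)) (by linarith [s5 i])
  obtain ⟨K, hK, hKe⟩ := key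
  refine ⟨1 / K ^ 2, by positivity, fun U => ?_⟩
  have h1 := hKe U
  have hE : 0 ≤ energy p U U := by
    by_contra! h
    have h2 : √(energy p U U) = 0 := Real.sqrt_eq_zero_of_nonpos h.le
    rw [h2, mul_zero, norm_le_zero_iff] at h1
    rw [h1, map_zero] at h
    simp at h
  rw [mul_assoc, one_div_mul_eq_div, div_le_iff₀ (by positivity), ← sq]
  calc ‖U‖ ^ 2 ≤ (K * √(energy p U U)) ^ 2 := by gcongr
    _ = energy p U U * K ^ 2 := by rw [mul_pow, Real.sq_sqrt hE]; ring

end Generator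
end LaminatedBeam
end

noncomputable section

namespace LaminatedBeam

/-! ### The group of the beam -/

section Group

theorem exists_atL_ne_zero {L : ℝ} (hL : 0 < L) : ∃ w : H1Star L, atL w ≠ 0 := by
  let c : L2 L := indicatorConstLp 2 (μ := volume.restrict (Ioo (0 : ℝ) L))
    MeasurableSet.univ (measure_ne_top _ _) (1 : ℝ)
  -- The witness is `w(x) = x`.
  obtain ⟨w, hw⟩ := exists_dx_eq hL.le c
  refine ⟨w, ?_⟩
  have h1 : atL w = ∫ _ in (0 : ℝ)..L, (1 : ℝ) := by
    rw [atL, hw]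
    refine intervalIntegral_congr_Ioo hL.le ?_
    filter_upwards [indicatorConstLp_coeFn (p := 2) (μ := volume.restrict (Ioo (0 : ℝ) L))
      (hs := MeasurableSet.univ) (hμs := measure_ne_top _ _) (c := (1 : ℝ))] with x hx
    exact hx.trans (by simp)
  rw [h1]
  simpa using hL.ne'

/-- Here `F` solves the variational identity with `U = 0`. Its displacements therefore vanish, and
its velocities and boundary velocities are, up to nonzero factors, derivatives and end point values
of the zero function. -/
theorem eq_zero_of_symp_eq_zero {p : Params} (hp : p.Positive) {F : Phase p.L}
    (h : ∀ W, symp p F W = 0) : F = 0 := by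
  have hL : 0 < p.L := hp.2.2.2.2.2
  have hm := Params.mass_pos hp
  have hw := Params.bweight_pos hp
  obtain ⟨hv, -, ⟨c0, h0⟩, ⟨c1, h1⟩, c2, h2⟩ := exists_isH1_of_energy_eq hp (U := 0) (F := F)
    (fun W => by rw [h, map_zero]; simp)
  have hz : IsH1 p.L 0 0 0 0 := by
    have := isH1_of_H1Star (0 : H1Star p.L)
    rwa [← atLCLM_apply hL.le, map_zero] at this
  have hs0 : shearC p.L 0 = 0 := map_zero _
  have hpos : ∀ i, F.pos i = 0 := fun i => fn_injective hL.le (hv i)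
  obtain ⟨w, hw0⟩ := exists_atL_ne_zero hL
  have key : ∀ {g : L2 p.L} {c A : ℝ}, IsH1 p.L 0 g c A → g = 0 ∧ A = 0 := by
    intro g c A hg
    have hg0 := hg.eq_of_ae hL.le hz
    refine ⟨hg0, ?_⟩
    subst hg0
    have := (exists_isH1_iff hL.le _ _ _).1 ⟨_, hg⟩ w
    simpa [hw0] using this
  obtain ⟨hρ₁, hρ₂, hk, hb, hγ, -⟩ := hp
  rw [hs0] at h0 h1 h2
  have g0 := key h0
  have g1 := key h1
  have g2 := key h2
  have hfn : fn ((0 : Phase p.L).pos 2) = 0 := rfl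
  rw [hfn] at g2
  simp [hρ₁.ne', hρ₂.ne', hk.ne', hb.ne'] at g0 g1 g2
  refine Prod.ext (funext hpos) (Prod.ext (funext fun i => ?_) (funext fun i => ?_))
  · fin_cases i
    · exact g0.1
    · exact g1.1
    · exact g2.1
  · fin_cases i
    · exact g0.2
    · exact g1.2
    · exact g2.2

/-- The inverse `R` of the generator and the group `S` it generates. -/
structure IsBeamGroup (p : Params) (R : Phase p.L →L[ℝ] Phase p.L)
    (S : ℝ → Phase p.L →L[ℝ] Phase p.L) : Prop where
  energy_R : ∀ x y, energy p (R x) y = -symp p x y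
  isGen_iff : ∀ U F, IsGen p U F ↔ U = R F
  inj : Function.Injective R
  zero : ∀ x, S 0 x = x
  add : ∀ s t x, S (s + t) x = S s (S t x)
  energy_S : ∀ t x y, energy p (S t x) (S t y) = energy p x y
  cont : ∀ x, Continuous fun t => S t x
  comm : ∀ t x, R (S t x) = S t (R x)
  integral : ∀ t x, R (S t x - x) = ∫ r in (0 : ℝ)..t, S r x

/-- `R` represents `-symp` in the energy product: antisymmetry of `symp` makes it skew,
nondegeneracy makes it injective. -/
theorem exists_isBeamGroup {p : Params} (hp : p.Positive) : ∃ R S, IsBeamGroup p R S := by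
  have hL : 0 ≤ p.L := hp.2.2.2.2.2.le
  obtain ⟨R, hR⟩ := exists_operator_of_isCoercive (energy_comm p) (isCoercive_energy hp)
    (symp p)
  have hinj : Function.Injective R := by
    refine (injective_iff_map_eq_zero R).2 fun F hF => eq_zero_of_symp_eq_zero hp fun W => ?_
    have := hR F W
    rw [hF, map_zero] at this
    simpa using this.symm
  have hskew : ∀ x y, energy p (R x) y = -energy p x (R y) := by
    intro x y
    rw [energy_comm p x, hR, hR, symp_neg p hL y x, neg_neg]
  obtain ⟨S, h0, h1, h2, h3, h4, h5⟩ := exists_group_of_isCoercive (energy_comm p)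
    (isCoercive_energy hp) hskew hinj
  refine ⟨R, S, hR, fun U F => ?_, hinj, h0, h1, h2, h3, h4, h5⟩
  rw [isGen_iff_energy hp]
  constructor
  · intro h
    exact eq_of_forall_form_eq (isCoercive_energy hp) fun W => by rw [h, hR]
  · rintro rfl W
    exact hR F W

namespace IsBeamGroup

variable {p : Params} {R : Phase p.L →L[ℝ] Phase p.L} {S : ℝ → Phase p.L →L[ℝ] Phase p.L}

theorem skew (G : IsBeamGroup p R S) (hp : p.Positive) (x y : Phase p.L) :
    energy p (R x) y = -energy p x (R y) := by
  rw [energy_comm p x, G.energy_R, G.energy_R, symp_neg p hp.2.2.2.2.2.le y x, neg_neg]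

/-- `symp` is `-energy p (R ·) ·`, and `R` commutes with the group, which preserves the energy. -/
theorem symp_S (G : IsBeamGroup p R S) (t : ℝ) (x y : Phase p.L) :
    symp p (S t x) (S t y) = symp p x y := by
  rw [← neg_inj, ← G.energy_R, ← G.energy_R, G.comm, G.energy_S]

theorem S_neg_S (G : IsBeamGroup p R S) (t : ℝ) (x : Phase p.L) : S t (S (-t) x) = x := by
  rw [← G.add, add_neg_cancel, G.zero]

theorem exists_norm_le (G : IsBeamGroup p R S) (hp : p.Positive) :
    ∃ C : ℝ, 0 < C ∧ ∀ t x, ‖S t x‖ ≤ C * ‖x‖ := by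
  obtain ⟨C, hC, h⟩ := exists_norm_le_of_form_eq (isCoercive_energy hp)
  exact ⟨C, hC, fun t x => h _ _ (G.energy_S t x x)⟩

theorem hasDerivAt (G : IsBeamGroup p R S) (x : Phase p.L) (t : ℝ) :
    HasDerivAt (fun t => S t (R x)) (S t x) t := by
  have h1 : (fun t => S t (R x)) = fun t => R x + ∫ r in (0 : ℝ)..t, S r x := by
    ext1 t
    rw [← G.integral, ← G.comm, ← map_add, add_sub_cancel]
  rw [h1]
  exact ((G.cont x).integral_hasStrictDerivAt 0 t).hasDerivAt.const_add _

theorem integral_sub (G : IsBeamGroup p R S) (τ t : ℝ) (x : Phase p.L) :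
    ∫ r in τ..t, S (r - τ) x = R (S (t - τ) x - x) := by
  rw [intervalIntegral.integral_comp_sub_right (fun r => S r x), sub_self, G.integral]

theorem isAdjointSolution (G : IsBeamGroup p R S) (τ : ℝ) (Z : Phase p.L) :
    IsAdjointSolution p τ (fun t => S (t - τ) Z) := by
  refine ⟨((G.cont Z).comp (continuous_id.sub continuous_const)).continuousOn, fun t _ => ?_⟩
  rw [G.isGen_iff, G.integral_sub]
  simp only [sub_self, G.zero]

/-- The difference `D` of the two solutions satisfies `R (D t) = ∫_τ^t D`, because they agree at
`τ`; uniqueness of mild solutions applies. -/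
theorem eq_of_isAdjointSolution (G : IsBeamGroup p R S) (hp : p.Positive) {τ : ℝ}
    {W : ℝ → Phase p.L} (hW : IsAdjointSolution p τ W) {t : ℝ} (ht : t ∈ Icc 0 τ) :
    W t = S (t - τ) (W τ) := by
  have hS : Continuous fun r => S (r - τ) (W τ) :=
    (G.cont _).comp (continuous_id.sub continuous_const)
  have h := eq_zero_of_eq_integral (energy_comm p) (isCoercive_energy hp) (G.skew hp) G.inj
    (hW.1.sub hS.continuousOn) (fun t ht => ?_) ht
  · exact sub_eq_zero.1 h
  · have h2 : IntervalIntegrable W volume τ t := by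
      refine (hW.1.mono ?_).intervalIntegrable
      rw [uIcc_of_ge ht.2]
      exact Icc_subset_Icc_left ht.1
    have h3 := (G.isGen_iff _ _).1 (hW.2 t ht)
    simp only [Pi.sub_apply]
    rw [intervalIntegral.integral_sub h2 (hS.intervalIntegrable _ _), h3, G.integral_sub,
      ← map_sub]
    congr 1
    abel

end IsBeamGroup

end Group
end LaminatedBeam
end

noncomputable section

namespace LaminatedBeam

/-! ### Hidden regularity of the boundary stresses -/

section HiddenTrace

/-- The form of the multiplier `x ∂ₓ`, for a given operator `X` on `L²(0, L)`. -/
def multiplierForm (p : Params) (X : L2 p.L →L[ℝ] L2 p.L) :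
    Phase p.L →L[ℝ] Phase p.L →L[ℝ] ℝ :=
  p.ρ₁ • innerForm (shearC p.L) (X ∘L velC p.L 0)
    + p.ρ₂ • innerForm (dxCLM p.L ∘L posC p.L 1) (X ∘L velC p.L 1)
    + p.ρ₂ • innerForm (dxCLM p.L ∘L posC p.L 2) (X ∘L velC p.L 2)

theorem multiplierForm_apply (p : Params) (X : L2 p.L →L[ℝ] L2 p.L) (U W : Phase p.L) :
    multiplierForm p X U W = p.ρ₁ * inner ℝ (shearC p.L U) (X (W.vel 0))
      + p.ρ₂ * inner ℝ (dx (U.pos 1)) (X (W.vel 1))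
      + p.ρ₂ * inner ℝ (dx (U.pos 2)) (X (W.vel 2)) := by
  simp [multiplierForm]

/-- The lower order terms of the multiplier identity. -/
def multiplierRest (p : Params) (X : L2 p.L →L[ℝ] L2 p.L) :
    Phase p.L →L[ℝ] Phase p.L →L[ℝ] ℝ :=
  p.ρ₁ • innerForm (velC p.L 1 + velC p.L 2) (X ∘L velC p.L 0)
    + (-1 / 2 : ℝ) • (p.ρ₁ • innerForm (velC p.L 0) (velC p.L 0)
      + p.ρ₂ • innerForm (velC p.L 1) (velC p.L 1)
      + p.ρ₂ • innerForm (velC p.L 2) (velC p.L 2)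
      + p.k • innerForm (shearC p.L) (shearC p.L)
      + p.b • innerForm (dxCLM p.L ∘L posC p.L 1) (dxCLM p.L ∘L posC p.L 1)
      + p.b • innerForm (dxCLM p.L ∘L posC p.L 2) (dxCLM p.L ∘L posC p.L 2))
    + (-p.k) • innerForm (dxCLM p.L ∘L posC p.L 1) (X ∘L shearC p.L)
    + (-(3 * p.k)) • innerForm (dxCLM p.L ∘L posC p.L 2) (X ∘L shearC p.L)
    + (-p.γ) • innerForm (dxCLM p.L ∘L posC p.L 2) (X ∘L fnCLM p.L ∘L posC p.L 2)

theorem multiplierRest_apply (p : Params) (X : L2 p.L →L[ℝ] L2 p.L) (U : Phase p.L) :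
    multiplierRest p X U U = p.ρ₁ * inner ℝ (U.vel 1 + U.vel 2) (X (U.vel 0))
      - 1 / 2 * (p.ρ₁ * inner ℝ (U.vel 0) (U.vel 0) + p.ρ₂ * inner ℝ (U.vel 1) (U.vel 1)
        + p.ρ₂ * inner ℝ (U.vel 2) (U.vel 2) + p.k * inner ℝ (shearC p.L U) (shearC p.L U)
        + p.b * inner ℝ (dx (U.pos 1)) (dx (U.pos 1)) + p.b * inner ℝ (dx (U.pos 2)) (dx (U.pos 2)))
      - p.k * inner ℝ (dx (U.pos 1)) (X (shearC p.L U))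
      - 3 * p.k * inner ℝ (dx (U.pos 2)) (X (shearC p.L U))
      - p.γ * inner ℝ (dx (U.pos 2)) (X (fn (U.pos 2))) := by
  simp only [multiplierRest, add_apply, smul_apply, innerForm_apply, ContinuousLinearMap.comp_apply,
    velC_apply, posC_apply, dxCLM_apply, fnCLM_apply, smul_eq_mul]
  ring

/-- The right side is the time derivative of `multiplierForm p X U U` when `U' = F`. By
`inner_mul_id` it splits into squares of values at `L` and terms quadratic in the state. The squares
of `U.bvel` enter with a positive sign and are dropped, whence an inequality. -/
theorem le_multiplierForm {p : Params} (hp : p.Positive) {X : L2 p.L →L[ℝ] L2 p.L}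
    (hX : ∀ f : L2 p.L, ∀ᵐ x ∂(volume.restrict (Ioo (0 : ℝ) p.L)), X f x = x * f x)
    (hs : ∀ f g : L2 p.L, inner ℝ (X f) g = (inner ℝ f (X g) : ℝ)) {U F : Phase p.L}
    (h : IsGen p U F) :
    p.L / 2 * (p.k * F.bvel 0 ^ 2 + p.b * F.bvel 1 ^ 2 + p.b * F.bvel 2 ^ 2)
      + multiplierRest p X U U ≤ multiplierForm p X F U + multiplierForm p X U F := by
  obtain ⟨hv, hbv, ⟨c0, h0⟩, ⟨c1, h1⟩, c2, h2⟩ :=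
    exists_isH1_of_energy_eq hp ((isGen_iff_energy hp).1 h)
  obtain ⟨hρ₁, hρ₂, hk, hb, hγ, hL⟩ := hp
  have hm : ∀ {f f' : L2 p.L} {a A : ℝ}, IsH1 p.L f f' a A →
      inner ℝ f' (X f) = (p.L * A ^ 2 - inner ℝ f f) / 2 := by
    intro f f' a A hf
    have := inner_mul_id hL.le hX hf
    rw [hs] at this
    linarith
  have hm' : ∀ {f f' : L2 p.L} {a A : ℝ}, IsH1 p.L f f' a A →
      inner ℝ f (X f') = (p.L * A ^ 2 - inner ℝ f f) / 2 := by
    intro f f' a A hf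
    rw [← hm hf, ← hs, real_inner_comm]
  have v : ∀ i, inner ℝ (dx (F.pos i)) (X (U.vel i)) =
      (p.L * U.bvel i ^ 2 - inner ℝ (U.vel i) (U.vel i)) / 2 := by
    intro i
    have := isH1_of_H1Star (F.pos i)
    rw [hv, ← hbv] at this
    exact hm this
  have e0 := hm' h0
  have e1 := hm' h1
  have e2 := hm' h2
  simp only [map_smul, map_add, inner_smul_right, inner_add_right, even_two, Even.neg_pow]
    at e0 e1 e2
  rw [div_mul_eq_mul_div, div_eq_iff hk.ne'] at e0
  rw [one_div, inv_mul_eq_iff_eq_mul₀ hb.ne'] at e1 e2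
  rw [multiplierForm_apply, multiplierForm_apply, multiplierRest_apply, shearC_apply F, hv, hv]
  simp only [inner_add_left, v]
  have p0 : 0 ≤ p.L * (p.ρ₁ * U.bvel 0 ^ 2) := by positivity
  have p1 : 0 ≤ p.L * (p.ρ₂ * U.bvel 1 ^ 2) := by positivity
  have p2 : 0 ≤ p.L * (p.ρ₂ * U.bvel 2 ^ 2) := by positivity
  linarith

/-- The multiplier method for a bounded group. -/
theorem exists_integral_le_of_multiplier {X : Type*} [NormedAddCommGroup X] [NormedSpace ℝ X]
    {R : X →L[ℝ] X} {S : ℝ → X →L[ℝ] X} {K : ℝ} (hK : 0 ≤ K) (hS : ∀ t x, ‖S t x‖ ≤ K * ‖x‖)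
    (hd : ∀ x t, HasDerivAt (fun t => S t (R x)) (S t x) t)
    (hcS : ∀ x, Continuous fun t => S t x) (hRS : ∀ t x, R (S t x) = S t (R x))
    (M Q : X →L[ℝ] X →L[ℝ] ℝ) {q : X → ℝ} (hq : Continuous q) {c : ℝ} (hc : 0 < c)
    (h : ∀ x, c * q x + Q (R x) (R x) ≤ M x (R x) + M (R x) x) {T : ℝ} (hT : 0 ≤ T) :
    ∃ C : ℝ, 0 ≤ C ∧ ∀ x, ∫ t in (0 : ℝ)..T, q (S t x) ≤ C * ‖R x‖ ^ 2 := by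
  -- The two end point values of `M` contribute `2 ‖M‖ K²`, the remainder `Q` contributes `‖Q‖ K²`
  -- per unit time.
  refine ⟨(2 * ‖M‖ * K ^ 2 + T * (‖Q‖ * K ^ 2)) / c, by positivity, fun Y => ?_⟩
  have hbd : ∀ (B : X →L[ℝ] X →L[ℝ] ℝ) t,
      |B (S t (R Y)) (S t (R Y))| ≤ ‖B‖ * K ^ 2 * ‖R Y‖ ^ 2 := by
    intro B t
    have h1 := B.le_opNorm₂ (S t (R Y)) (S t (R Y))
    rw [Real.norm_eq_abs] at h1
    have h2 := hS t (R Y)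
    calc _ ≤ ‖B‖ * ‖S t (R Y)‖ * ‖S t (R Y)‖ := h1
      _ ≤ ‖B‖ * (K * ‖R Y‖) * (K * ‖R Y‖) := by gcongr
      _ = _ := by ring
  have hd' : ∀ t, HasDerivAt (fun t => M (S t (R Y)) (S t (R Y)))
      (M (S t Y) (S t (R Y)) + M (S t (R Y)) (S t Y)) t := fun t =>
    (M.hasFDerivAt.comp_hasDerivAt t (hd Y t)).clm_apply (hd Y t)
  have hcont : Continuous fun t => M (S t Y) (S t (R Y)) + M (S t (R Y)) (S t Y) :=
    ((M.continuous.comp (hcS Y)).clm_apply (hcS _)).add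
      ((M.continuous.comp (hcS _)).clm_apply (hcS _))
  have hcb : Continuous fun t => q (S t Y) := hq.comp (hcS Y)
  have hint := intervalIntegral.integral_eq_sub_of_hasDerivAt (a := 0) (b := T)
    (fun t _ => hd' t) (hcont.intervalIntegrable _ _)
  have hpt : ∀ t, c * q (S t Y) - ‖Q‖ * K ^ 2 * ‖R Y‖ ^ 2 ≤
      M (S t Y) (S t (R Y)) + M (S t (R Y)) (S t Y) := by
    intro t
    have h1 := h (S t Y)
    rw [hRS] at h1
    have h2 := (abs_le.1 (hbd Q t)).1
    linarith
  have h1 := intervalIntegral.integral_mono_on hT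
    (((hcb.const_mul c).sub continuous_const).intervalIntegrable (μ := volume) 0 T)
    (hcont.intervalIntegrable _ _) (fun t _ => hpt t)
  simp only [Pi.sub_apply] at h1
  rw [hint, intervalIntegral.integral_sub ((hcb.const_mul c).intervalIntegrable _ _)
    intervalIntegrable_const, intervalIntegral.integral_const_mul,
    intervalIntegral.integral_const, sub_zero, smul_eq_mul] at h1
  have h2 := (abs_le.1 (hbd M T)).2
  have h3 := (abs_le.1 (hbd M 0)).1
  rw [div_mul_eq_mul_div, le_div_iff₀ hc]
  linarith

/-- `(S t Y).bvel` is minus the boundary stress of the trajectory `S t (R Y)`. The bound is by the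
norm of `R Y`, whereas boundedness of `bvel` alone would only give one by the norm of `Y`. -/
theorem IsBeamGroup.exists_integral_bvel_le {p : Params}
    {R : Phase p.L →L[ℝ] Phase p.L} {S : ℝ → Phase p.L →L[ℝ] Phase p.L}
    (G : IsBeamGroup p R S) (hp : p.Positive) {T : ℝ} (hT : 0 ≤ T) :
    ∃ C : ℝ, 0 ≤ C ∧ ∀ Y, ∫ t in (0 : ℝ)..T, ∑ i, (S t Y).bvel i ^ 2 ≤ C * ‖R Y‖ ^ 2 := by
  obtain ⟨X, hX, hs⟩ := exists_mul_id p.L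
  obtain ⟨K, hK, hS⟩ := G.exists_norm_le hp
  have hL : 0 < p.L := hp.2.2.2.2.2
  have hk : 0 < p.k := hp.2.2.1
  have hb : 0 < p.b := hp.2.2.2.1
  refine exists_integral_le_of_multiplier hK.le hS G.hasDerivAt G.cont G.comm
    (multiplierForm p X) (multiplierRest p X) (q := fun Y => ∑ i, Y.bvel i ^ 2)
    (c := p.L / 2 * min p.k p.b) ?_ (by positivity) (fun x => ?_) hT
  · exact continuous_finsetSum _ fun i _ => (bvelC p.L i).continuous.pow 2
  · have h1 := le_multiplierForm hp hX hs ((G.isGen_iff (R x) x).2 rfl)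
    have h3 : p.L / 2 * min p.k p.b * ∑ i, x.bvel i ^ 2 ≤ p.L / 2 * (p.k * x.bvel 0 ^ 2
        + p.b * x.bvel 1 ^ 2 + p.b * x.bvel 2 ^ 2) := by
      rw [Fin.sum_univ_three, mul_assoc]
      have m1 := mul_le_mul_of_nonneg_right (min_le_left p.k p.b) (sq_nonneg (x.bvel 0))
      have m2 := mul_le_mul_of_nonneg_right (min_le_right p.k p.b) (sq_nonneg (x.bvel 1))
      have m3 := mul_le_mul_of_nonneg_right (min_le_right p.k p.b) (sq_nonneg (x.bvel 2))
      refine mul_le_mul_of_nonneg_left ?_ (half_pos hL).le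
      linarith
    linarith

end HiddenTrace
end LaminatedBeam
end

noncomputable section

namespace LaminatedBeam

/-! ### Duhamel's formula with an admissible control vector -/

section Duhamel

/-- Cauchy–Schwarz, from the discriminant of `∫ (x f + g)²` in `x`. -/
theorem abs_intervalIntegral_mul_le {a b : ℝ} (hab : a ≤ b) {f g : ℝ → ℝ}
    (hf : IntervalIntegrable (fun r => f r ^ 2) volume a b)
    (hg : IntervalIntegrable (fun r => g r ^ 2) volume a b)
    (hfg : IntervalIntegrable (fun r => f r * g r) volume a b) :
    |∫ r in a..b, f r * g r| ≤ √(∫ r in a..b, f r ^ 2) * √(∫ r in a..b, g r ^ 2) := by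
  have hf0 : 0 ≤ ∫ r in a..b, f r ^ 2 :=
    intervalIntegral.integral_nonneg hab fun r _ => sq_nonneg _
  have h := discrim_le_zero (a := ∫ r in a..b, f r ^ 2) (b := 2 * ∫ r in a..b, f r * g r)
    (c := ∫ r in a..b, g r ^ 2) fun x => by
      have h1 : 0 ≤ ∫ r in a..b, (x * f r + g r) ^ 2 :=
        intervalIntegral.integral_nonneg hab fun r _ => sq_nonneg _
      have h2 : ∀ r, (x * f r + g r) ^ 2 = x * x * f r ^ 2 + 2 * x * (f r * g r) + g r ^ 2 :=
        fun r => by ring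
      simp only [h2] at h1
      rw [intervalIntegral.integral_add ((hf.const_mul _).add (hfg.const_mul _)) hg,
        intervalIntegral.integral_add (hf.const_mul _) (hfg.const_mul _),
        intervalIntegral.integral_const_mul, intervalIntegral.integral_const_mul] at h1
      linarith
  rw [← Real.sqrt_mul hf0]
  refine Real.abs_le_sqrt ?_
  rw [discrim] at h
  linarith

variable {X : Type*} [NormedAddCommGroup X] [NormedSpace ℝ X]

theorem continuousOn_group_apply {S : ℝ → X →L[ℝ] X} {K : ℝ} (hS : ∀ t x, ‖S t x‖ ≤ K * ‖x‖)
    (hcS : ∀ x, Continuous fun t => S t x) {s : Set ℝ} {z : ℝ → X} (hz : ContinuousOn z s) :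
    ContinuousOn (fun t => S t (z t)) s := by
  intro t ht
  have h1 : Tendsto (fun r => S r (z r - z t)) (𝓝[s] t) (𝓝 0) := by
    refine squeeze_zero_norm (fun r => hS r _) ?_
    have h2 : Tendsto (fun r => K * ‖z r - z t‖) (𝓝[s] t) (𝓝 (K * ‖z t - z t‖)) :=
      (((hz t ht).sub_const (z t)).norm).const_mul K
    rwa [sub_self, norm_zero, mul_zero] at h2
  have h3 : Tendsto (fun r => S r (z t)) (𝓝[s] t) (𝓝 (S t (z t))) :=
    ((hcS (z t)).tendsto t).mono_left nhdsWithin_le_nhds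
  have h4 := h1.add h3
  rw [zero_add] at h4
  refine h4.congr fun r => ?_
  rw [← map_add, sub_add_cancel]

theorem intervalIntegrable_smul_group {S : ℝ → X →L[ℝ] X} (hcS : ∀ x, Continuous fun t => S t x)
    {T : ℝ} {u : ℝ → ℝ} (hu : IntervalIntegrable u volume 0 T) (b : X) {s t : ℝ}
    (hs : s ∈ Icc 0 T) (ht : t ∈ Icc 0 T) :
    IntervalIntegrable (fun r => u r • S (-r) b) volume s t := by
  refine (hu.smul_continuousOn ((hcS b).comp continuous_neg).continuousOn).mono_set ?_
  have hT : 0 ≤ T := hs.1.trans hs.2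
  rw [uIcc_of_le hT]
  exact uIcc_subset_Icc hs ht

/-- The solution of `U' = R⁻¹ U + u b`, `U(T) = 0`. -/
def duhamel (S : ℝ → X →L[ℝ] X) (b : X) (u : ℝ → ℝ) (T t : ℝ) : X :=
  -S t (∫ r in t..T, u r • S (-r) b)

theorem duhamel_self (S : ℝ → X →L[ℝ] X) (b : X) (u : ℝ → ℝ) (T : ℝ) : duhamel S b u T T = 0 := by
  simp [duhamel]

variable [CompleteSpace X]

/-- A vector `b` that is admissible for the group gives a Duhamel integral in the domain of the
generator, continuous for the graph norm. -/
theorem exists_preimage_duhamel {e : X →L[ℝ] X →L[ℝ] ℝ} (hs : ∀ x y, e x y = e y x)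
    (hc : IsCoercive e) {R : X →L[ℝ] X} (hR : ∀ x y, e (R x) y = -e x (R y))
    (hinj : Function.Injective R) {S : ℝ → X →L[ℝ] X} {K : ℝ} (hS : ∀ t x, ‖S t x‖ ≤ K * ‖x‖)
    (hcS : ∀ x, Continuous fun t => S t x) (hRS : ∀ t x, R (S t x) = S t (R x))
    (hSe : ∀ t x y, e (S (-t) x) y = e x (S t y))
    {b : X} {T C : ℝ} (hT : 0 ≤ T) (hC : 0 ≤ C)
    (hb : ∀ y, ∫ t in (0 : ℝ)..T, e b (S t y) ^ 2 ≤ C * ‖R y‖ ^ 2) {u : ℝ → ℝ}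
    (hu : IntervalIntegrable u volume 0 T)
    (hu2 : IntervalIntegrable (fun r => u r ^ 2) volume 0 T) :
    ∃ AU : ℝ → X, ContinuousOn AU (Icc 0 T) ∧
      ∀ t ∈ Icc 0 T, R (AU t) = duhamel S b u T t := by
  obtain ⟨K', hK', hpre⟩ := exists_preimage_of_forall_le hs hc hR hinj
  have hsub : ∀ {s t : ℝ}, s ∈ Icc 0 T → t ∈ Icc 0 T → uIcc s t ⊆ uIcc 0 T := by
    intro s t hs ht
    rw [uIcc_of_le hT]
    exact uIcc_subset_Icc hs ht
  -- Against `y` the integral becomes `∫ u e(b, S r y)`, which Cauchy–Schwarz and `hb` bound by a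
  -- multiple of `‖R y‖`. So `exists_preimage_of_forall_le` puts it in the range of `R`, with a
  -- preimage controlled by the `L²(s, t)` norm of `u`.
  have key : ∀ s ∈ Icc 0 T, ∀ t ∈ Icc 0 T, s ≤ t → ∃ z, R z = ∫ r in s..t, u r • S (-r) b ∧
      ‖z‖ ≤ K' * (√(∫ r in s..t, u r ^ 2) * √C) := by
    intro s hs t ht hst
    refine hpre _ _ (by positivity) fun y => ?_
    have hφ : Continuous fun r => e b (S r y) := (e b).continuous.comp (hcS y)
    have h1 : e (∫ r in s..t, u r • S (-r) b) y = ∫ r in s..t, u r * e b (S r y) := by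
      have h2 := (e.flip y).intervalIntegral_comp_comm
        (intervalIntegrable_smul_group hcS hu b hs ht)
      rw [ContinuousLinearMap.flip_apply] at h2
      rw [← h2]
      refine intervalIntegral.integral_congr fun r _ => ?_
      simp [hSe]
    have h3 := abs_intervalIntegral_mul_le hst (hu2.mono_set (hsub hs ht))
      ((hφ.pow 2).intervalIntegrable s t)
      ((hu.mono_set (hsub hs ht)).mul_continuousOn hφ.continuousOn)
    rw [h1, mul_assoc]
    refine h3.trans (mul_le_mul_of_nonneg_left ?_ (Real.sqrt_nonneg _))
    rw [← Real.sqrt_sq (norm_nonneg (R y)), ← Real.sqrt_mul hC]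
    refine Real.sqrt_le_sqrt (le_trans ?_ (hb y))
    exact intervalIntegral.integral_mono_interval hs.1 hst ht.2
      (Eventually.of_forall fun r => sq_nonneg _) ((hφ.pow 2).intervalIntegrable 0 T)
  have hTm : T ∈ Icc 0 T := right_mem_Icc.2 hT
  choose! z hz using fun t ht => key t ht T hTm ht.2
  have hdiff : ∀ s ∈ Icc 0 T, ∀ t ∈ Icc 0 T, s ≤ t →
      ‖z s - z t‖ ≤ K' * (√(∫ r in s..t, u r ^ 2) * √C) := by
    intro s hs t ht hst
    obtain ⟨w, hw, hwn⟩ := key s hs t ht hst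
    have : z s - z t = w := by
      refine hinj ?_
      rw [map_sub, (hz s hs).1, (hz t ht).1, hw, sub_eq_iff_eq_add,
        intervalIntegral.integral_add_adjacent_intervals
          (intervalIntegrable_smul_group hcS hu b hs ht)
          (intervalIntegrable_smul_group hcS hu b ht hTm)]
    rwa [this]
  -- The primitive of `u²` provides the modulus of continuity of `z`.
  let Φ : ℝ → ℝ := fun t => ∫ r in (0 : ℝ)..t, u r ^ 2
  have hΦ : ContinuousOn Φ (Icc 0 T) := by
    have := intervalIntegral.continuousOn_primitive_interval' hu2 left_mem_uIcc
    rwa [uIcc_of_le hT] at this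
  have hΦd : ∀ s ∈ Icc 0 T, ∀ t ∈ Icc 0 T, ∫ r in s..t, u r ^ 2 = Φ t - Φ s := by
    intro s hs t ht
    exact (intervalIntegral.integral_interval_sub_left
      (hu2.mono_set (hsub (left_mem_Icc.2 hT) ht)) (hu2.mono_set (hsub (left_mem_Icc.2 hT) hs))).symm
  have hle : ∀ s ∈ Icc 0 T, ∀ t ∈ Icc 0 T, ‖z s - z t‖ ≤ K' * (√|Φ s - Φ t| * √C) := by
    intro s hs t ht
    rcases le_total s t with h | h
    · refine (hdiff s hs t ht h).trans ?_
      rw [hΦd s hs t ht, abs_sub_comm]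
      gcongr
      exact le_abs_self _
    · rw [norm_sub_rev]
      refine (hdiff t ht s hs h).trans ?_
      rw [hΦd t ht s hs]
      gcongr
      exact le_abs_self _
  have hzc : ContinuousOn z (Icc 0 T) := by
    intro t ht
    refine tendsto_iff_norm_sub_tendsto_zero.2 ?_
    refine squeeze_zero' (Eventually.of_forall fun _ => norm_nonneg _)
      (eventually_nhdsWithin_of_forall fun s hs => hle s hs t ht) ?_
    have h1 : Tendsto (fun s => K' * (√|Φ s - Φ t| * √C)) (𝓝[Icc 0 T] t)
        (𝓝 (K' * (√|Φ t - Φ t| * √C))) :=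
      (((((hΦ t ht).sub_const _).abs).sqrt).mul_const _).const_mul _
    simpa using h1
  refine ⟨fun t => -S t (z t), (continuousOn_group_apply hS hcS hzc).neg, fun t ht => ?_⟩
  rw [map_neg, hRS, (hz t ht).1, duhamel]

theorem form_duhamel {ω : X →L[ℝ] X →L[ℝ] ℝ} {S : ℝ → X →L[ℝ] X}
    (hcS : ∀ x, Continuous fun t => S t x) (hω : ∀ t x y, ω (S t x) (S t y) = ω x y)
    (hω' : ∀ t x y, ω (S (-t) x) y = ω x (S t y)) (b : X) {T : ℝ} {u : ℝ → ℝ}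
    (hu : IntervalIntegrable u volume 0 T) {τ : ℝ} (hτ : τ ∈ Icc 0 T) (y : X) :
    ω (duhamel S b u T τ) (S τ y) = -∫ r in τ..T, u r * ω b (S r y) := by
  have hT : T ∈ Icc 0 T := right_mem_Icc.2 (hτ.1.trans hτ.2)
  have h2 := (ω.flip y).intervalIntegral_comp_comm
    (intervalIntegrable_smul_group hcS hu b hτ hT)
  rw [ContinuousLinearMap.flip_apply] at h2
  rw [duhamel, map_neg, neg_apply, hω, ← h2]
  congr 1
  refine intervalIntegral.integral_congr fun r _ => ?_
  simp [hω']

/-- Formally `R U' = U + u R b`, and `V (R b) = 0` removes the control. The derivative hence exists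
at every time, although `u` is merely integrable. -/
theorem hasDerivWithinAt_duhamel {E : Type*} [NormedAddCommGroup E] [NormedSpace ℝ E]
    [CompleteSpace E] {R : X →L[ℝ] X} {S : ℝ → X →L[ℝ] X} {K : ℝ}
    (hS : ∀ t x, ‖S t x‖ ≤ K * ‖x‖) (hadd : ∀ s t x, S (s + t) x = S s (S t x))
    (hcS : ∀ x, Continuous fun t => S t x) (hRS : ∀ t x, R (S t x) = S t (R x))
    (hd : ∀ x t, HasDerivAt (fun t => S t (R x)) (S t x) t)
    (hint : ∀ t x, R (S t x - x) = ∫ r in (0 : ℝ)..t, S r x) (V : X →L[ℝ] E) {b : X}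
    (hVb : V (R b) = 0) {T : ℝ} {u : ℝ → ℝ} (hu : IntervalIntegrable u volume 0 T) {t : ℝ}
    (ht : t ∈ Icc 0 T) :
    HasDerivWithinAt (fun r => V (R (duhamel S b u T r))) (V (duhamel S b u T t)) (Icc 0 T) t := by
  have hT0 : 0 ≤ T := ht.1.trans ht.2
  have hT : T ∈ Icc 0 T := right_mem_Icc.2 hT0
  have hS0 : ∀ x, 0 ≤ K * ‖x‖ := fun x => (norm_nonneg _).trans (hS 0 x)
  -- `B s` is the contribution of the control between `t` and `s`. As `V (R b) = 0`, its kernel is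
  -- `V (R (S (s - r) b - b)) = O(|s - t|)`; the integral of `|u|` over the shrinking interval makes
  -- `B s` an `o(|s - t|)`.
  let B : ℝ → E := fun s => V (R (S s (∫ r in t..s, u r • S (-r) b)))
  let Φ : ℝ → ℝ := fun s => |∫ r in t..s, ‖u r‖|
  have hut : ∀ s ∈ Icc 0 T, IntervalIntegrable u volume t s := fun s hs => by
    refine hu.mono_set ?_
    rw [uIcc_of_le hT0]
    exact uIcc_subset_Icc ht hs
  have hB : ∀ s ∈ Icc 0 T, ‖B s‖ ≤ ‖V‖ * (K * ‖b‖) * |s - t| * Φ s := by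
    intro s hs
    have h1 := (V ∘L R ∘L S s).intervalIntegral_comp_comm
      (intervalIntegrable_smul_group hcS hu b ht hs)
    have h2 : B s = ∫ r in t..s, u r • V (R (S (s - r) b - b)) := by
      change V (R (S s _)) = _
      simp only [ContinuousLinearMap.comp_apply] at h1
      rw [← h1]
      refine intervalIntegral.integral_congr fun r _ => ?_
      simp only [map_smul]
      rw [← hadd, map_sub R, map_sub V, hVb, sub_zero, sub_eq_add_neg]
    have h3 : ∀ r ∈ uIcc t s, ‖V (R (S (s - r) b - b))‖ ≤ ‖V‖ * (K * ‖b‖) * |s - t| := by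
      intro r hr
      have h4 : ‖R (S (s - r) b - b)‖ ≤ K * ‖b‖ * |s - r - 0| := by
        rw [hint]
        exact intervalIntegral.norm_integral_le_of_norm_le_const fun q _ => hS q b
      have h5 : |s - r| ≤ |s - t| := abs_sub_right_of_mem_uIcc hr
      rw [sub_zero] at h4
      calc _ ≤ ‖V‖ * (K * ‖b‖ * |s - r|) :=
            (V.le_opNorm _).trans (mul_le_mul_of_nonneg_left h4 (norm_nonneg _))
        _ ≤ ‖V‖ * (K * ‖b‖ * |s - t|) :=
            mul_le_mul_of_nonneg_left (mul_le_mul_of_nonneg_left h5 (hS0 b)) (norm_nonneg _)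
        _ = _ := by ring
    have hc0 : 0 ≤ ‖V‖ * (K * ‖b‖) * |s - t| :=
      mul_nonneg (mul_nonneg (norm_nonneg _) (hS0 b)) (abs_nonneg _)
    have h6 := intervalIntegral.norm_integral_le_abs_of_norm_le
      (f := fun r => u r • V (R (S (s - r) b - b))) (a := t) (b := s) (μ := volume)
      (g := fun r => ‖V‖ * (K * ‖b‖) * |s - t| * ‖u r‖) (by
        refine (ae_restrict_iff' measurableSet_uIoc).2 (Eventually.of_forall fun r hr => ?_)
        rw [norm_smul, mul_comm]
        exact mul_le_mul_of_nonneg_right (h3 r (uIoc_subset_uIcc hr)) (norm_nonneg _))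
      ((hut s hs).norm.const_mul _)
    rwa [← h2, intervalIntegral.integral_const_mul, abs_mul, abs_of_nonneg hc0] at h6
  have hΦ : Tendsto Φ (𝓝[Icc 0 T] t) (𝓝 0) := by
    have h1 := (intervalIntegral.continuousOn_primitive_interval' hu.norm (by
      rwa [uIcc_of_le hT0] : t ∈ uIcc 0 T)).abs
    rw [uIcc_of_le hT0] at h1
    have h2 := h1 t ht
    simpa [ContinuousWithinAt, Φ] using h2
  have hBd : HasDerivWithinAt B 0 (Icc 0 T) t := by
    rw [hasDerivWithinAt_iff_tendsto]
    have hBt : B t = 0 := by simp [B]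
    refine squeeze_zero' (g := fun s => ‖V‖ * (K * ‖b‖) * Φ s)
      (Eventually.of_forall fun _ => by positivity)
      (eventually_nhdsWithin_of_forall fun s hs => ?_) ?_
    · rw [hBt, sub_zero, smul_zero, sub_zero]
      have h0 : 0 ≤ ‖V‖ * (K * ‖b‖) * Φ s :=
        mul_nonneg (mul_nonneg (norm_nonneg _) (hS0 b)) (abs_nonneg _)
      rcases eq_or_ne s t with rfl | hst
      · simpa using h0
      · have h1 : 0 < ‖s - t‖ := norm_pos_iff.2 (sub_ne_zero.2 hst)
        rw [inv_mul_le_iff₀ h1]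
        refine (hB s hs).trans_eq ?_
        rw [Real.norm_eq_abs]
        ring
    · simpa using hΦ.const_mul (‖V‖ * (K * ‖b‖))
  have hA : HasDerivAt (fun s => V (S s (R (S (-t) (duhamel S b u T t)))))
      (V (S t (S (-t) (duhamel S b u T t)))) t :=
    V.hasFDerivAt.comp_hasDerivAt t (hd _ t)
  have hz : ∀ x, S t (S (-t) x) = S 0 x := fun x => by rw [← hadd, add_neg_cancel]
  have hz0 : ∀ x, S 0 (S t x) = S t x := fun x => by rw [← hadd, zero_add]
  have hfin := hA.hasDerivWithinAt (s := Icc 0 T) |>.add hBd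
  have hdz : S 0 (duhamel S b u T t) = duhamel S b u T t := by
    rw [duhamel, map_neg, hz0]
  rw [add_zero, hz, hdz] at hfin
  refine hfin.congr_of_mem (fun s hs => ?_) ht
  simp only [Pi.add_apply, B]
  rw [← map_add, ← hRS, ← map_add]
  congr 2
  have h1 := intervalIntegral.integral_add_adjacent_intervals
    (intervalIntegrable_smul_group hcS hu b ht hs) (intervalIntegrable_smul_group hcS hu b hs hT)
  rw [duhamel, duhamel, ← h1, map_neg, map_neg]
  simp only [← hadd, neg_add_cancel]
  simp only [add_zero, map_add]
  abel

end Duhamel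
end LaminatedBeam
end

noncomputable section

namespace LaminatedBeam

/-! ### Sufficiency of the moment identity -/

section Sufficiency

/-- The states with zero displacements and velocities and with a unit boundary velocity. -/
def bvec (L : ℝ) (i : Fin 3) : Phase L := (0, 0, Pi.single i 1)

/-- This turns the admissibility of the control vectors into the hidden trace estimate. -/
theorem energy_bvec (p : Params) (i : Fin 3) (Y : Phase p.L) :
    energy p (bvec p.L i) Y = p.bweight i * Y.bvel i := by
  have h1 : ∀ j, (bvec p.L i).pos j = 0 := fun j => rfl
  have h2 : ∀ j, (bvec p.L i).vel j = 0 := fun j => rfl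
  have h3 : (bvec p.L i).bvel = Pi.single i 1 := rfl
  have hd : dx (0 : H1Star p.L) = 0 := rfl
  have hf : fn (0 : H1Star p.L) = 0 := rfl
  simp [energy_apply, shearC_apply, h1, h2, h3, hd, hf, Pi.single_apply]

/-- This makes the Duhamel integral produce the control terms of the transposition identity. -/
theorem symp_bvec (p : Params) (hL : 0 ≤ p.L) (i : Fin 3) (W : Phase p.L) :
    symp p (bvec p.L i) W = p.bweight i * atL (W.pos i) := by
  have h1 : ∀ j, (bvec p.L i).pos j = 0 := fun j => rfl
  have h2 : ∀ j, (bvec p.L i).vel j = 0 := fun j => rfl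
  have h3 : (bvec p.L i).bvel = Pi.single i 1 := rfl
  have hf : fn (0 : H1Star p.L) = 0 := rfl
  have ha : atL (0 : H1Star p.L) = 0 := by rw [← atLCLM_apply hL, map_zero]
  simp [symp_apply p hL, h1, h2, h3, hf, ha, Pi.single_apply]

theorem intervalIntegrable_of_memLp {T : ℝ} (hT : 0 ≤ T) {u : ℝ → ℝ}
    (hu : MemLp u 2 (volume.restrict (Ioo 0 T))) :
    IntervalIntegrable u volume 0 T ∧ IntervalIntegrable (fun r => u r ^ 2) volume 0 T := by
  rw [intervalIntegrable_iff_integrableOn_Ioo_of_le hT,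
    intervalIntegrable_iff_integrableOn_Ioo_of_le hT]
  exact ⟨hu.integrable (by norm_num), hu.integrable_sq⟩

theorem controlPairing_congr {p : Params} {τ : ℝ} (hτ : 0 ≤ τ) (u : Fin 3 → ℝ → ℝ)
    {W V : ℝ → Phase p.L}
    (h : EqOn W V (Icc 0 τ)) : controlPairing p τ u W = controlPairing p τ u V := by
  refine Finset.sum_congr rfl fun i _ => ?_
  congr 1
  refine intervalIntegral.integral_congr fun t ht => ?_
  rw [uIcc_of_le hτ] at ht
  simp only [h ht]

namespace IsBeamGroup

variable {p : Params} {R : Phase p.L →L[ℝ] Phase p.L} {S : ℝ → Phase p.L →L[ℝ] Phase p.L}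

theorem vel_R (G : IsBeamGroup p R S) (F : Phase p.L) (i : Fin 3) :
    (R F).vel i = fn (F.pos i) := by
  obtain ⟨_, _, _, _, h, -⟩ := (G.isGen_iff (R F) F).2 rfl
  exact (h i).symm

theorem bvel_R (G : IsBeamGroup p R S) (F : Phase p.L) (i : Fin 3) :
    (R F).bvel i = atL (F.pos i) := by
  obtain ⟨_, _, _, _, -, h, -⟩ := (G.isGen_iff (R F) F).2 rfl
  exact h i

theorem energy_neg (G : IsBeamGroup p R S) (t : ℝ) (x y : Phase p.L) :
    energy p (S (-t) x) y = energy p x (S t y) := by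
  rw [← G.energy_S t, G.S_neg_S]

theorem symp_S_neg (G : IsBeamGroup p R S) (t : ℝ) (x y : Phase p.L) :
    symp p (S (-t) x) y = symp p x (S t y) := by
  rw [← G.symp_S t, G.S_neg_S]

theorem continuous_atL (G : IsBeamGroup p R S) (hL : 0 ≤ p.L) (Z : Phase p.L) (i : Fin 3) :
    Continuous fun t => atL ((S t Z).pos i) := by
  have h : Continuous fun t => atLCLM p.L (posC p.L i (S t Z)) :=
    (atLCLM p.L).continuous.comp ((posC p.L i).continuous.comp (G.cont Z))
  simpa only [posC_apply, atLCLM_apply hL] using h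

theorem exists_preimage (G : IsBeamGroup p R S) (hp : p.Positive) {T : ℝ} (hT : 0 ≤ T) (i : Fin 3)
    {u : ℝ → ℝ} (hu : MemLp u 2 (volume.restrict (Ioo 0 T))) :
    ∃ AU : ℝ → Phase p.L, ContinuousOn AU (Icc 0 T) ∧
      ∀ t ∈ Icc 0 T, R (AU t) = duhamel S (bvec p.L i) u T t := by
  obtain ⟨K, -, hS⟩ := G.exists_norm_le hp
  obtain ⟨C, hC, hbv⟩ := G.exists_integral_bvel_le hp hT
  obtain ⟨hu1, hu2⟩ := intervalIntegrable_of_memLp hT hu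
  refine exists_preimage_duhamel (energy_comm p) (isCoercive_energy hp) (G.skew hp) G.inj hS G.cont
    G.comm G.energy_neg hT (C := p.bweight i ^ 2 * C) (by positivity) (fun y => ?_) hu1 hu2
  have hc : ∀ j, Continuous fun t => (S t y).bvel j ^ 2 := fun j =>
    ((bvelC p.L j).continuous.comp (G.cont y)).pow 2
  simp only [energy_bvec, mul_pow]
  rw [intervalIntegral.integral_const_mul, mul_assoc]
  refine mul_le_mul_of_nonneg_left (le_trans ?_ (hbv y)) (sq_nonneg _)
  refine intervalIntegral.integral_mono_on hT ((hc i).intervalIntegrable _ _)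
    ((continuous_finsetSum _ fun j _ => hc j).intervalIntegrable _ _) fun t _ => ?_
  exact Finset.single_le_sum (f := fun j => (S t y).bvel j ^ 2) (fun j _ => sq_nonneg _)
    (Finset.mem_univ i)

/-- The velocity of `R F` is the displacement of `F`, so `velC p.L j` annihilates `R (bvec p.L i)`,
as the Duhamel lemma requires. -/
theorem hasDerivWithinAt_vel (G : IsBeamGroup p R S) (hp : p.Positive) {T : ℝ} {u : ℝ → ℝ}
    (hu : IntervalIntegrable u volume 0 T) (i j : Fin 3) {t : ℝ} (ht : t ∈ Icc 0 T) :
    HasDerivWithinAt (fun r => fn ((duhamel S (bvec p.L i) u T r).pos j))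
      ((duhamel S (bvec p.L i) u T t).vel j) (Icc 0 T) t := by
  obtain ⟨K, -, hS⟩ := G.exists_norm_le hp
  have h := hasDerivWithinAt_duhamel hS G.add G.cont G.comm G.hasDerivAt G.integral (velC p.L j)
    (b := bvec p.L i) (by rw [velC_apply, G.vel_R]; rfl) hu ht
  simpa only [velC_apply, G.vel_R] using h

theorem controlPairing_split (G : IsBeamGroup p R S) (hL : 0 ≤ p.L) {T τ : ℝ} (hτ : τ ∈ Icc 0 T)
    {u : Fin 3 → ℝ → ℝ} (hu : ∀ i, IntervalIntegrable (u i) volume 0 T) (Z : Phase p.L) :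
    controlPairing p T u (fun t => S t Z) = controlPairing p τ u (fun t => S t Z)
      + ∑ i, ∫ t in τ..T, u i t * (p.bweight i * atL ((S t Z).pos i)) := by
  rw [controlPairing, controlPairing, ← Finset.sum_add_distrib]
  refine Finset.sum_congr rfl fun i _ => ?_
  have hT : 0 ≤ T := hτ.1.trans hτ.2
  have h0 : IntervalIntegrable (fun t => u i t * atL ((S t Z).pos i)) volume 0 T :=
    (hu i).mul_continuousOn (G.continuous_atL hL Z i).continuousOn
  have h1 : IntervalIntegrable (fun t => u i t * atL ((S t Z).pos i)) volume 0 τ := by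
    refine h0.mono_set ?_
    rw [uIcc_of_le hT, uIcc_of_le hτ.1]
    exact Icc_subset_Icc_right hτ.2
  have h2 : IntervalIntegrable (fun t => u i t * atL ((S t Z).pos i)) volume τ T := by
    refine h0.mono_set ?_
    rw [uIcc_of_le hT, uIcc_of_le hτ.2]
    exact Icc_subset_Icc_left hτ.1
  simp only [mul_left_comm _ (p.bweight i)]
  rw [intervalIntegral.integral_const_mul, ← mul_add,
    intervalIntegral.integral_add_adjacent_intervals h1 h2]

/-- A solution of the adjoint system on `[0, τ]` is a trajectory of the group. -/
theorem eqOn_of_isAdjointSolution (G : IsBeamGroup p R S) (hp : p.Positive) {τ : ℝ}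
    {W : ℝ → Phase p.L} (hW : IsAdjointSolution p τ W) :
    EqOn W (fun t => S t (S (-τ) (W τ))) (Icc 0 τ) := fun t ht => by
  rw [G.eq_of_isAdjointSolution hp hW ht, sub_eq_add_neg, G.add]

theorem isAdjointSolution_orbit (G : IsBeamGroup p R S) (τ : ℝ) (Z : Phase p.L) :
    IsAdjointSolution p τ fun t => S t Z := by
  have h := G.isAdjointSolution τ (S τ Z)
  simpa only [← G.add, sub_add_cancel] using h

/-- The solution is the sum of the backward Duhamel integrals. Its `symp` product with an orbit is
minus the control integral over `[τ, T]`, and subtracting this part from the identity over `[0, T]`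
leaves the one over `[0, τ]`. -/
theorem steersToZero (G : IsBeamGroup p R S) (hp : p.Positive) {T : ℝ} (hT : 0 ≤ T)
    {D : DualDatum p.L} {u : Fin 3 → ℝ → ℝ}
    (hu : ∀ i, MemLp (u i) 2 (volume.restrict (Ioo 0 T)))
    (h : ∀ Z, -pairing p D (S 0 Z) - boundaryPairing p D (S 0 Z) =
      controlPairing p T u fun t => S t Z) :
    SteersToZero p T u D := by
  have hL : 0 ≤ p.L := hp.2.2.2.2.2.le
  have hu1 := fun i => (intervalIntegrable_of_memLp hT (hu i)).1
  choose AU hAU hRAU using fun i => G.exists_preimage hp hT i (hu i)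
  let U : ℝ → Phase p.L := fun t => ∑ i, duhamel S (bvec p.L i) (u i) T t
  have hRU : ∀ t ∈ Icc 0 T, U t = R (∑ i, AU i t) := fun t ht => by
    rw [map_sum]
    exact Finset.sum_congr rfl fun i _ => (hRAU i t ht).symm
  have hAUc : ContinuousOn (fun t => ∑ i, AU i t) (Icc 0 T) :=
    continuousOn_finsetSum _ fun i _ => hAU i
  refine ⟨U, ⟨⟨fun t => ∑ i, AU i t, fun t ht => (G.isGen_iff _ _).2 (hRU t ht),
    (R.continuous.comp_continuousOn hAUc).congr hRU, hAUc⟩, fun t ht j => ?_,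
    fun τ hτ W hW hW0 => ?_⟩, ?_⟩
  · have h1 := HasDerivWithinAt.fun_sum (u := Finset.univ)
      fun i _ => G.hasDerivWithinAt_vel hp (hu1 i) i j ht
    have h2 : ∀ r, fn ((U r).pos j) = ∑ i, fn ((duhamel S (bvec p.L i) (u i) T r).pos j) :=
      fun r => map_sum (fnCLM p.L ∘L posC p.L j)
        (fun i => duhamel S (bvec p.L i) (u i) T r) Finset.univ
    have h3 : (U t).vel j = ∑ i, (duhamel S (bvec p.L i) (u i) T t).vel j :=
      map_sum (velC p.L j) (fun i => duhamel S (bvec p.L i) (u i) T t) Finset.univ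
    simpa only [h2, h3] using h1
  · have hWS := G.eqOn_of_isAdjointSolution hp hW
    set Z := S (-τ) (W τ)
    have e1 : W τ = S τ Z := hWS (right_mem_Icc.2 hτ.1)
    have e0 : W 0 = S 0 Z := hWS (left_mem_Icc.2 hτ.1)
    have h1 : symp p (U τ) (W τ) =
        -∑ i, ∫ t in τ..T, u i t * (p.bweight i * atL ((S t Z).pos i)) := by
      have h2 : symp p (U τ) (W τ) = ∑ i, symp p (duhamel S (bvec p.L i) (u i) T τ) (W τ) := by
        simp only [U, map_sum, sum_apply]
      rw [h2, ← Finset.sum_neg_distrib]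
      refine Finset.sum_congr rfl fun i _ => ?_
      rw [e1, form_duhamel G.cont G.symp_S G.symp_S_neg _ (hu1 i) hτ]
      simp only [symp_bvec p hL]
    -- The vanishing traces of `W τ` are what identifies `symp` with `pairing` here.
    have h2 : boundaryPairing p (U τ).toDual (W τ) = 0 :=
      Finset.sum_eq_zero fun i _ => by rw [hW0, mul_zero]
    have h3 := h Z
    have h4 := G.controlPairing_split hL hτ hu1 Z
    have h5 := symp_eq_pairing p hL (U τ) (W τ)
    rw [controlPairing_congr hτ.1 u hWS, e0]
    linarith
  · exact Finset.sum_eq_zero fun i _ => duhamel_self S _ _ T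

end IsBeamGroup

end Sufficiency
end LaminatedBeam
end

noncomputable section

namespace LaminatedBeam

/-! ### Asymptotics near the final time -/

section Necessity

/-- Functionals that vanish on the common kernel of three functionals tend to zero if they do so
fast enough on vectors to which the three functionals are asymptotically dual. -/
theorem tendsto_zero_of_ker_le {V : Type*} [AddCommGroup V] [Module ℝ V] {l : Filter ℝ}
    {s : ℝ → ℝ} {Λ : ℝ → V → ℝ} {tr : ℝ → Fin 3 → V →ₗ[ℝ] ℝ}
    (h0 : ∀ᶠ τ in l, IsLinearMap ℝ (Λ τ))
    (h1 : ∀ᶠ τ in l, ∀ x, (∀ i, tr τ i x = 0) → Λ τ x = 0) (hs : ∀ᶠ τ in l, s τ ≠ 0)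
    {z : Fin 3 → V} (h2 : ∀ j, (fun τ => Λ τ (z j)) =o[l] s)
    (h3 : ∀ i j, (fun τ => tr τ i (z j) - if i = j then s τ else 0) =o[l] s) {y : V}
    (hy : ∀ i, (fun τ => tr τ i y) =O[l] fun _ => (1 : ℝ)) :
    Tendsto (fun τ => Λ τ y) l (𝓝 0) := by
  rw [← Asymptotics.isLittleO_one_iff ℝ, Asymptotics.isLittleO_iff]
  intro ε hε
  choose K hK hyK using fun i => (hy i).exists_pos
  have hK3 : 0 < ∑ i, K i := Finset.sum_pos (fun i _ => hK i) Finset.univ_nonempty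
  -- With `N = ∑ |cᵢ|`, the three inequalities `|cⱼ| ≤ η + N / 6` add up to `N ≤ 3η + N / 2`, so `N
  -- ≤ 6η`, and `η = ε / (6 ∑ K)` gives `|Λ τ y| ≤ ε`.
  have e1 := eventually_all.2 fun j =>
    (h2 j).bound (show 0 < ε / (6 * ∑ i, K i) by positivity)
  have e2 := eventually_all.2 fun i => eventually_all.2 fun j =>
    (h3 i j).bound (show (0 : ℝ) < 1 / 6 by norm_num)
  have e3 := eventually_all.2 fun i => (hyK i).bound
  filter_upwards [h0, h1, hs, e1, e2, e3] with τ h0 h1 hs e1 e2 e3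
  -- Vanishing on the common kernel makes `Λ τ` a combination of the three functionals, with
  -- coefficients that depend on `τ`.
  have hker : ⨅ i, (tr τ i).ker ≤ (h0.mk').ker := by
    intro x hx
    rw [Submodule.mem_iInf] at hx
    exact h1 x hx
  obtain ⟨c, hc⟩ := Submodule.mem_span_range_iff_exists_fun ℝ |>.1 (mem_span_of_iInf_ker_le_ker hker)
  have hΛ : ∀ x, Λ τ x = ∑ i, c i * tr τ i x := fun x => by
    rw [← IsLinearMap.mk'_apply h0, ← hc]
    simp
  set η := ε / (6 * ∑ i, K i)
  have hs0 : 0 < |s τ| := abs_pos.2 hs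
  have hcj : ∀ j, |c j| ≤ η + (∑ i, |c i|) / 6 := by
    intro j
    have h4 : c j * s τ = Λ τ (z j) - ∑ i, c i * (tr τ i (z j) - if i = j then s τ else 0) := by
      rw [hΛ]
      simp [mul_sub, Finset.sum_sub_distrib]
    have h5 : |∑ i, c i * (tr τ i (z j) - if i = j then s τ else 0)| ≤
        ∑ i, |c i| * (1 / 6 * |s τ|) := by
      refine (Finset.abs_sum_le_sum_abs _ _).trans (Finset.sum_le_sum fun i _ => ?_)
      rw [abs_mul]
      exact mul_le_mul_of_nonneg_left (e2 i j) (abs_nonneg _)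
    have h6 : |c j| * |s τ| ≤ η * |s τ| + ∑ i, |c i| * (1 / 6 * |s τ|) := by
      rw [← abs_mul, h4]
      exact (abs_sub _ _).trans (add_le_add (e1 j) h5)
    rw [← Finset.sum_mul] at h6
    refine le_of_mul_le_mul_right ?_ hs0
    linarith
  have hN : ∑ i, |c i| ≤ 6 * η := by
    have h7 := Finset.sum_le_sum fun j (_ : j ∈ Finset.univ) => hcj j
    simp only [Finset.sum_const, Finset.card_univ, Fintype.card_fin, nsmul_eq_mul] at h7
    push_cast at h7
    linarith
  have h8 : |Λ τ y| ≤ (∑ i, |c i|) * ∑ i, K i := by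
    rw [hΛ, Finset.sum_mul]
    refine (Finset.abs_sum_le_sum_abs _ _).trans (Finset.sum_le_sum fun i _ => ?_)
    rw [abs_mul]
    refine mul_le_mul_of_nonneg_left ?_ (abs_nonneg _)
    have h9 := e3 i
    rw [norm_one, mul_one] at h9
    exact h9.trans (Finset.single_le_sum (f := K) (fun j _ => (hK j).le) (Finset.mem_univ i))
  rw [norm_one, mul_one]
  refine h8.trans ((mul_le_mul_of_nonneg_right hN hK3.le).trans_eq ?_)
  simp only [η]
  field_simp

theorem tendsto_integral_left {T : ℝ} (hT : 0 < T) {f : ℝ → ℝ}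
    (hf : IntervalIntegrable f volume 0 T) :
    Tendsto (fun τ => ∫ t in τ..T, f t) (𝓝[<] T) (𝓝 0) := by
  have h1 := intervalIntegral.continuousOn_primitive_interval' hf right_mem_uIcc
  rw [uIcc_of_le hT.le] at h1
  have h2 : Tendsto (fun b => -∫ t in T..b, f t) (𝓝[Icc 0 T] T) (𝓝 (-∫ t in T..T, f t)) :=
    (h1 T (right_mem_Icc.2 hT.le)).neg
  rw [intervalIntegral.integral_same, neg_zero] at h2
  simp only [← intervalIntegral.integral_symm] at h2
  refine h2.mono_left ?_
  rw [← nhdsWithin_Ioo_eq_nhdsLT hT]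
  exact nhdsWithin_mono _ Ioo_subset_Icc_self

/-- Near `T` from the left, whatever holds eventually holds on whole intervals `[τ, T]`. -/
theorem eventually_forall_Icc {T : ℝ} (hT : 0 < T) {P : ℝ → Prop}
    (h : ∀ᶠ t in 𝓝[Icc 0 T] T, P t) : ∀ᶠ τ in 𝓝[<] T, τ ∈ Ico 0 T ∧ ∀ t ∈ Icc τ T, P t := by
  obtain ⟨δ, hδ, hP⟩ := Metric.mem_nhdsWithin_iff.1 h
  have h1 : Ioo (max 0 (T - δ)) T ∈ 𝓝[<] T :=
    Ioo_mem_nhdsLT (max_lt hT (by linarith))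
  filter_upwards [h1] with τ hτ
  have h2 := (le_max_left _ _).trans hτ.1.le
  have h3 := (le_max_right 0 (T - δ)).trans_lt hτ.1
  refine ⟨⟨h2, hτ.2⟩, fun t ht => hP ⟨?_, h2.trans ht.1, ht.2⟩⟩
  rw [Metric.mem_ball, Real.dist_eq, abs_lt]
  constructor <;> linarith [ht.1, ht.2]

/-- On `[τ, T]` one has `|φ| ≤ K |τ - T|`, and the other factor `∫_τ^T |u|` tends to zero, so
integrability of `u` suffices. -/
theorem isLittleO_integral_mul {T : ℝ} (hT : 0 < T) {u φ : ℝ → ℝ}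
    (hu : IntervalIntegrable u volume 0 T)
    (hφ : φ =O[𝓝 T] fun t => t - T) :
    (fun τ => ∫ t in τ..T, u t * φ t) =o[𝓝[<] T] fun τ => τ - T := by
  obtain ⟨K, hK, hb⟩ := hφ.exists_pos
  have h1 := eventually_forall_Icc hT (hb.bound.filter_mono nhdsWithin_le_nhds)
  have h2 := tendsto_integral_left hT hu.norm
  rw [Asymptotics.isLittleO_iff]
  intro ε hε
  have h3 : ∀ᶠ τ in 𝓝[<] T, |∫ t in τ..T, ‖u t‖| < ε / K := by
    have := h2.abs.eventually_lt_const (u := ε / K) (by rw [abs_zero]; positivity)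
    exact this
  filter_upwards [h1, h3] with τ ⟨hτ, h1⟩ h3
  have hint : IntervalIntegrable (fun t => K * |τ - T| * ‖u t‖) volume τ T := by
    refine (hu.norm.const_mul _).mono_set ?_
    rw [uIcc_of_le hT.le]
    exact uIcc_subset_Icc (Ico_subset_Icc_self hτ) (right_mem_Icc.2 hT.le)
  have h4 := intervalIntegral.norm_integral_le_abs_of_norm_le (f := fun t => u t * φ t)
    (μ := volume) (a := τ) (b := T) (g := fun t => K * |τ - T| * ‖u t‖) (by
      refine (ae_restrict_iff' measurableSet_uIoc).2 (Eventually.of_forall fun r hr => ?_)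
      rw [uIoc_of_le hτ.2.le] at hr
      have h5 := h1 r (Ioc_subset_Icc_self hr)
      have h6 : ‖r - T‖ ≤ |τ - T| := by
        rw [Real.norm_eq_abs, abs_of_nonpos (by linarith [hr.2]), abs_of_nonpos (by linarith [hτ.2])]
        linarith [hr.1]
      rw [norm_mul, mul_comm]
      exact mul_le_mul_of_nonneg_right (h5.trans (mul_le_mul_of_nonneg_left h6 hK.le))
        (norm_nonneg _)) hint
  rw [intervalIntegral.integral_const_mul, abs_mul, abs_of_nonneg (by positivity)] at h4
  refine h4.trans ?_
  rw [lt_div_iff₀ hK] at h3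
  rw [Real.norm_eq_abs]
  nlinarith [abs_nonneg (τ - T)]

end Necessity
end LaminatedBeam
end

noncomputable section

namespace LaminatedBeam

/-! ### Necessity of the moment identity -/

section Moments

theorem isLinearMap_pairing (p : Params) (D : DualDatum p.L) : IsLinearMap ℝ (pairing p D) := by
  constructor
  · intro x y
    have h1 : ∀ i, (x + y).pos i = x.pos i + y.pos i := fun _ => rfl
    have h2 : ∀ i, (x + y).vel i = x.vel i + y.vel i := fun _ => rfl
    have h3 : ∀ i, (x + y).bvel i = x.bvel i + y.bvel i := fun _ => rfl
    simp only [pairing, h1, h2, h3, map_add, inner_add_right, ← Finset.sum_add_distrib]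
    exact Finset.sum_congr rfl fun i _ => by ring
  · intro c x
    have h1 : ∀ i, (c • x).pos i = c • x.pos i := fun _ => rfl
    have h2 : ∀ i, (c • x).vel i = c • x.vel i := fun _ => rfl
    have h3 : ∀ i, (c • x).bvel i = c * x.bvel i := fun _ => rfl
    simp only [pairing, h1, h2, h3, map_smul, inner_smul_right, smul_eq_mul, Finset.mul_sum]
    exact Finset.sum_congr rfl fun i _ => by ring

theorem atL_pos_add {L : ℝ} (hL : 0 ≤ L) (x y : Phase L) (i : Fin 3) :
    atL ((x + y).pos i) = atL (x.pos i) + atL (y.pos i) := by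
  rw [← atLCLM_apply hL, ← atLCLM_apply hL, ← atLCLM_apply hL, ← map_add]
  rfl

theorem atL_pos_smul {L : ℝ} (hL : 0 ≤ L) (c : ℝ) (x : Phase L) (i : Fin 3) :
    atL ((c • x).pos i) = c * atL (x.pos i) := by
  rw [← atLCLM_apply hL, ← atLCLM_apply hL, ← smul_eq_mul, ← map_smul]
  rfl

theorem isLinearMap_boundaryPairing {p : Params} (hL : 0 ≤ p.L) (D : DualDatum p.L) :
    IsLinearMap ℝ (boundaryPairing p D) := by
  constructor
  · intro x y
    simp only [boundaryPairing, atL_pos_add hL, ← Finset.sum_add_distrib]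
    exact Finset.sum_congr rfl fun i _ => by ring
  · intro c x
    simp only [boundaryPairing, atL_pos_smul hL, smul_eq_mul, Finset.mul_sum]
    exact Finset.sum_congr rfl fun i _ => by ring

theorem IsBeamGroup.isLinearMap_controlPairing {p : Params} {R : Phase p.L →L[ℝ] Phase p.L}
    {S : ℝ → Phase p.L →L[ℝ] Phase p.L} (G : IsBeamGroup p R S) (hL : 0 ≤ p.L) {τ : ℝ}
    {u : Fin 3 → ℝ → ℝ} (hu : ∀ i, IntervalIntegrable (u i) volume 0 τ) :
    IsLinearMap ℝ fun Z => controlPairing p τ u fun t => S t Z := by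
  have hi : ∀ Z i, IntervalIntegrable (fun t => u i t * atL ((S t Z).pos i)) volume 0 τ :=
    fun Z i => (hu i).mul_continuousOn (G.continuous_atL hL Z i).continuousOn
  constructor
  · intro x y
    simp only [controlPairing, map_add, atL_pos_add hL, mul_add, ← Finset.sum_add_distrib]
    refine Finset.sum_congr rfl fun i _ => ?_
    rw [intervalIntegral.integral_add (hi x i) (hi y i), mul_add]
  · intro c x
    simp only [controlPairing, map_smul, atL_pos_smul hL, smul_eq_mul, Finset.mul_sum]
    refine Finset.sum_congr rfl fun i _ => ?_
    simp only [mul_left_comm _ c]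
    rw [intervalIntegral.integral_const_mul]
    ring

/-- Each product has one factor of order `g` and one bounded factor, and one of the two is small. It
serves with `g = τ - T` on the dual orbits and with `g = 1` on an arbitrary one. -/
theorem isLittleO_pairing {p : Params} (hL : 0 ≤ p.L) {l : Filter ℝ} {U W : ℝ → Phase p.L}
    {g : ℝ → ℝ} (hU : ∀ i, (fun τ => (U τ).pos i) =o[l] g)
    (hV : ∀ i, Tendsto (fun τ => (U τ).vel i) l (𝓝 0))
    (hW : ∀ i, (fun τ => fn ((W τ).pos i)) =O[l] g)
    (hWv : ∀ i, (fun τ => (W τ).vel i) =O[l] fun _ => (1 : ℝ))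
    (hWb : ∀ i, (fun τ => (W τ).bvel i) =O[l] fun _ => (1 : ℝ)) :
    (fun τ => pairing p (U τ).toDual (W τ)) =o[l] g := by
  have hin : ∀ (f h : ℝ → L2 p.L), (fun τ => (inner ℝ (f τ) (h τ) : ℝ)) =O[l]
      fun τ => ‖f τ‖ * ‖h τ‖ := fun f h => Asymptotics.IsBigO.of_bound 1 <|
    Eventually.of_forall fun τ => by
      rw [one_mul, norm_mul, norm_norm, norm_norm]
      exact norm_inner_le_norm _ _
  have h1 : ∀ i, (fun τ => (inner ℝ ((U τ).vel i) (fn ((W τ).pos i)) : ℝ)) =o[l] g := fun i => by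
    have h := (((Asymptotics.isLittleO_one_iff ℝ).2 (hV i)).norm_left).mul_isBigO (hW i).norm_left
    simp only [one_mul] at h
    exact (hin _ _).trans_isLittleO h
  have hf : ∀ i, (fun τ => fn ((U τ).pos i)) =o[l] g := fun i =>
    ((fnCLM p.L).isBigO_comp (fun τ => (U τ).pos i) l).trans_isLittleO (hU i)
  have ha : ∀ i, (fun τ => atL ((U τ).pos i)) =o[l] g := fun i => by
    have h := ((atLCLM p.L).isBigO_comp (fun τ => (U τ).pos i) l).trans_isLittleO (hU i)
    simpa only [Function.comp_def, atLCLM_apply hL] using h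
  have h2 : ∀ i, (fun τ => (inner ℝ (fn ((U τ).pos i)) ((W τ).vel i) : ℝ)) =o[l] g := fun i => by
    have h := (hf i).norm_left.mul_isBigO (hWv i).norm_left
    simp only [mul_one] at h
    exact (hin _ _).trans_isLittleO h
  have h3 : ∀ i, (fun τ => atL ((U τ).pos i) * (W τ).bvel i) =o[l] g := fun i => by
    have h := (ha i).mul_isBigO (hWb i)
    simpa only [mul_one] using h
  simp only [pairing]
  refine Asymptotics.IsLittleO.fun_sum fun i _ => ?_
  have h := (((h1 i).const_mul_left (p.mass i)).sub ((h2 i).const_mul_left (p.mass i))).sub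
    ((h3 i).const_mul_left (p.bweight i))
  refine h.congr_left fun τ => ?_
  rw [mul_assoc (p.bweight i)]
  rfl

/-- The displacement of a state that reaches zero at time `T` is `o(T - τ)`. -/
theorem isLittleO_pos {p : Params} (hp : p.Positive) {T : ℝ} (hT : 0 < T) {U AU : ℝ → Phase p.L}
    (hgen : ∀ t ∈ Icc 0 T, IsGen p (U t) (AU t)) (hUc : ContinuousOn U (Icc 0 T))
    (hAU : ContinuousOn AU (Icc 0 T)) (hAT : AU T = 0)
    (hd : ∀ t ∈ Icc 0 T, ∀ i,
      HasDerivWithinAt (fun r => fn ((U r).pos i)) ((U t).vel i) (Icc 0 T) t)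
    (hUT : U T = 0) (i : Fin 3) :
    (fun τ => (U τ).pos i) =o[𝓝[<] T] fun τ => τ - T := by
  have hL : 0 ≤ p.L := hp.2.2.2.2.2.le
  have hpos : ContinuousOn (fun t => (AU t).pos i) (Icc 0 T) :=
    (posC p.L i).continuous.comp_continuousOn hAU
  -- The derivative is known only in `L²`; injectivity of `fn` lifts the integral formula to `H¹`,
  -- where the displacements of `AU` are continuous.
  have hrep : ∀ τ ∈ Icc 0 T, (U τ).pos i = -∫ t in τ..T, (AU t).pos i := by
    intro τ hτ
    refine fn_injective hL ?_
    have hsub : Icc τ T ⊆ Icc 0 T := Icc_subset_Icc_left hτ.1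
    have hint : IntervalIntegrable (fun t => (AU t).pos i) volume τ T := by
      refine (hpos.mono ?_).intervalIntegrable
      rwa [uIcc_of_le hτ.2]
    have h1 := (fnCLM p.L).intervalIntegral_comp_comm hint
    have h2 : ∫ t in τ..T, fnCLM p.L ((AU t).pos i) =
        fn ((U T).pos i) - fn ((U τ).pos i) := by
      refine intervalIntegral.integral_eq_sub_of_hasDerivAt_of_le
        (f := fun t => fn ((U t).pos i)) hτ.2
        ((fnCLM p.L).continuous.comp_continuousOn
          ((posC p.L i).continuous.comp_continuousOn (hUc.mono hsub))) (fun t ht => ?_) ?_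
      · obtain ⟨_, _, _, _, h, -⟩ := hgen t (hsub (Ioo_subset_Icc_self ht))
        rw [fnCLM_apply, h i]
        exact (hd t (hsub (Ioo_subset_Icc_self ht)) i).hasDerivAt
          (Icc_mem_nhds (hτ.1.trans_lt ht.1) ht.2)
      · refine ((fnCLM p.L).continuous.comp_continuousOn (hpos.mono ?_)).intervalIntegrable
        rwa [uIcc_of_le hτ.2]
    have h3 : fn ((U T).pos i) = 0 := by rw [hUT]; rfl
    rw [h1, h3, zero_sub] at h2
    change fn _ = fnCLM p.L (-_)
    rw [map_neg, h2, neg_neg]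
  rw [Asymptotics.isLittleO_iff]
  intro ε hε
  have h0 : Tendsto (fun t => ‖(AU t).pos i‖) (𝓝[Icc 0 T] T) (𝓝 0) := by
    have h : Tendsto (fun t => ‖(AU t).pos i‖) (𝓝[Icc 0 T] T) (𝓝 ‖(AU T).pos i‖) :=
      (hpos T (right_mem_Icc.2 hT.le)).norm
    have hz : (AU T).pos i = 0 := by rw [hAT]; rfl
    rwa [hz, norm_zero] at h
  filter_upwards [eventually_forall_Icc hT (h0.eventually_le_const hε)] with τ ⟨hτ, h⟩
  rw [hrep τ (Ico_subset_Icc_self hτ), norm_neg, Real.norm_eq_abs, abs_sub_comm]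
  refine intervalIntegral.norm_integral_le_of_norm_le_const fun t ht => h t ?_
  rw [uIoc_of_le hτ.2.le] at ht
  exact Ioc_subset_Icc_self ht

namespace IsBeamGroup

variable {p : Params} {R : Phase p.L →L[ℝ] Phase p.L} {S : ℝ → Phase p.L →L[ℝ] Phase p.L}

theorem hasDerivAt_fn (G : IsBeamGroup p R S) (Z : Phase p.L) (i : Fin 3) (t : ℝ) :
    HasDerivAt (fun t => fn ((S t Z).pos i)) ((S t Z).vel i) t := by
  have h := (velC p.L i).hasFDerivAt.comp_hasDerivAt t (G.hasDerivAt Z t)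
  refine h.congr_of_eventuallyEq (Eventually.of_forall fun r => ?_)
  simp only [Function.comp_apply, velC_apply]
  rw [← G.comm, G.vel_R]

theorem hasDerivAt_atL (G : IsBeamGroup p R S) (Z : Phase p.L) (i : Fin 3) (t : ℝ) :
    HasDerivAt (fun t => atL ((S t Z).pos i)) ((S t Z).bvel i) t := by
  have h := (bvelC p.L i).hasFDerivAt.comp_hasDerivAt t (G.hasDerivAt Z t)
  refine h.congr_of_eventuallyEq (Eventually.of_forall fun r => ?_)
  simp only [Function.comp_apply, bvelC_apply]
  rw [← G.comm, G.bvel_R]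

/-- At `τ = T` the transposition identity covers only those `Z` for which the traces of `S T Z`
vanish. The other directions are recovered from the identities at `τ < T` in the limit `τ → T`. -/
theorem moment_of_steersToZero (G : IsBeamGroup p R S) (hp : p.Positive) {T : ℝ} (hT : 0 < T)
    {D : DualDatum p.L} {u : Fin 3 → ℝ → ℝ}
    (hu : ∀ i, MemLp (u i) 2 (volume.restrict (Ioo 0 T))) (h : SteersToZero p T u D)
    (Z : Phase p.L) :
    -pairing p D Z - boundaryPairing p D Z = controlPairing p T u fun t => S t Z := by
  have hL : 0 ≤ p.L := hp.2.2.2.2.2.le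
  have hu1 := fun i => (intervalIntegrable_of_memLp hT.le (hu i)).1
  obtain ⟨U, ⟨⟨AU, hgen, hUc, hAUc⟩, hd, hid⟩, hUT⟩ := h
  have hTm : T ∈ Icc 0 T := right_mem_Icc.2 hT.le
  have hAT : AU T = 0 := by
    refine G.inj ?_
    rw [← (G.isGen_iff _ _).1 (hgen T hTm), hUT, map_zero]
  have hoU := isLittleO_pos hp hT hgen hUc hAUc hAT hd hUT
  have hlt : 𝓝[<] T ≤ 𝓝[Icc 0 T] T := by
    rw [← nhdsWithin_Ioo_eq_nhdsLT hT]
    exact nhdsWithin_mono _ Ioo_subset_Icc_self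
  have hU0 : Tendsto U (𝓝[<] T) (𝓝 0) := by
    have := (hUc T hTm).mono_left hlt
    rwa [hUT] at this
  have hV : ∀ i, Tendsto (fun τ => (U τ).vel i) (𝓝[<] T) (𝓝 0) := fun i => by
    have := ((velC p.L i).continuous.tendsto 0).comp hU0
    rwa [map_zero] at this
  have hU1 : ∀ i, (fun τ => (U τ).pos i) =o[𝓝[<] T] fun _ => (1 : ℝ) := fun i => by
    have := ((posC p.L i).continuous.tendsto 0).comp hU0
    rw [map_zero] at this
    exact (Asymptotics.isLittleO_one_iff ℝ).2 this
  have hO : ∀ {E : Type} [NormedAddCommGroup E] {f : ℝ → E}, Continuous f →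
      f =O[𝓝[<] T] fun _ => (1 : ℝ) := fun hf =>
    ((hf.tendsto T).mono_left nhdsWithin_le_nhds).isBigO_one ℝ
  have hSv : ∀ Y i, (fun τ => (S τ Y).vel i) =O[𝓝[<] T] fun _ => (1 : ℝ) := fun Y i =>
    hO ((velC p.L i).continuous.comp (G.cont Y))
  have hSb : ∀ Y i, (fun τ => (S τ Y).bvel i) =O[𝓝[<] T] fun _ => (1 : ℝ) := fun Y i =>
    hO ((bvelC p.L i).continuous.comp (G.cont Y))
  have hSf : ∀ Y i, (fun τ => fn ((S τ Y).pos i)) =O[𝓝[<] T] fun _ => (1 : ℝ) := fun Y i =>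
    hO ((fnCLM p.L).continuous.comp ((posC p.L i).continuous.comp (G.cont Y)))
  let H : ℝ → Phase p.L → ℝ := fun τ Y => pairing p D Y + boundaryPairing p D Y
    + controlPairing p τ u fun t => S t Y
  -- The defect of the transposition identity at time `τ`, as a functional of the adjoint state at
  -- time `0`.
  let Λ : ℝ → Phase p.L → ℝ := fun τ Y => pairing p (U τ).toDual (S τ Y) - H τ Y
  have hΛ : ∀ τ ∈ Icc 0 T, ∀ Y, (∀ i, atL ((S τ Y).pos i) = 0) → Λ τ Y = 0 := by
    intro τ hτ Y hY
    have h1 := hid τ hτ _ (G.isAdjointSolution_orbit τ Y) hY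
    rw [G.zero] at h1
    simp only [Λ, H, h1]
    ring
  have hHsub : ∀ τ ∈ Icc 0 T, ∀ Y, H τ Y =
      H T Y - ∑ i, ∫ t in τ..T, u i t * (p.bweight i * atL ((S t Y).pos i)) := by
    intro τ hτ Y
    simp only [H, G.controlPairing_split hL hτ hu1 Y]
    ring
  have hev : ∀ᶠ τ in 𝓝[<] T, τ ∈ Icc 0 T := hlt self_mem_nhdsWithin
  -- The orbit of `z j` passes at time `T` through `bvec p.L j`, which has zero displacements and a
  -- unit boundary velocity. Its `i`-th trace at time `τ` is therefore `(τ - T) δᵢⱼ + o(τ - T)`.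
  let z : Fin 3 → Phase p.L := fun j => S (-T) (bvec p.L j)
  have hz : ∀ j, S T (z j) = bvec p.L j := fun j => G.S_neg_S T _
  have hbf : ∀ i j, fn ((bvec p.L j).pos i) = 0 := fun i j => rfl
  have hba : ∀ i j, atL ((bvec p.L j).pos i) = 0 := fun i j => by
    change atL (0 : H1Star p.L) = 0
    rw [← atLCLM_apply hL, map_zero]
  have hpT : ∀ Y, pairing p (U T).toDual Y = 0 := by
    intro Y
    have h1 := symp_eq_pairing p hL (U T) Y
    have h2 : boundaryPairing p (U T).toDual Y = 0 := by
      rw [hUT]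
      refine Finset.sum_eq_zero fun i _ => ?_
      change p.bweight i * 0 * _ = 0
      ring
    have h3 : symp p (U T) Y = 0 := by rw [hUT, map_zero]; rfl
    linarith
  -- The traces of `S T (z j)` vanish, so the identity at time `T` itself applies, and `U T = 0`
  -- removes its left side.
  have hHz : ∀ j, H T (z j) = 0 := by
    intro j
    have h1 := hΛ T hTm (z j) fun i => by rw [hz, hba]
    simp only [Λ, hpT] at h1
    linarith
  have hatz : ∀ i j, (fun t => atL ((S t (z j)).pos i)) =O[𝓝 T] fun t => t - T := fun i j => by
    have h1 := (G.hasDerivAt_atL (z j) i T).isBigO_sub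
    simpa only [hz, hba, sub_zero] using h1
  have key := tendsto_zero_of_ker_le (l := 𝓝[<] T) (s := fun τ => τ - T) (Λ := Λ)
    (tr := fun τ i => ((atLCLM p.L ∘L posC p.L i ∘L S τ : Phase p.L →L[ℝ] ℝ) :
      Phase p.L →ₗ[ℝ] ℝ)) (z := z) (y := Z) ?_ ?_ ?_ ?_ ?_ ?_
  -- `Λ τ Z` tends both to zero and to `-H T Z`.
  · have h1 : Tendsto (fun τ => pairing p (U τ).toDual (S τ Z)) (𝓝[<] T) (𝓝 0) :=
      (Asymptotics.isLittleO_one_iff ℝ).1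
        (isLittleO_pairing hL hU1 hV (hSf Z) (hSv Z) (hSb Z))
    have h2 : Tendsto (fun τ => H τ Z) (𝓝[<] T) (𝓝 (H T Z)) := by
      have h3 : Tendsto (fun τ => H T Z -
          ∑ i, ∫ t in τ..T, u i t * (p.bweight i * atL ((S t Z).pos i))) (𝓝[<] T)
          (𝓝 (H T Z - ∑ _i : Fin 3, 0)) := by
        refine tendsto_const_nhds.sub (tendsto_finsetSum _ fun i _ => tendsto_integral_left hT ?_)
        exact (hu1 i).mul_continuousOn ((G.continuous_atL hL Z i).const_mul _).continuousOn
      rw [Finset.sum_const_zero, sub_zero] at h3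
      exact h3.congr' (hev.mono fun τ hτ => (hHsub τ hτ Z).symm)
    have h4 := tendsto_nhds_unique key (h1.sub h2)
    simp only [H] at h4
    linarith
  · filter_upwards [hev] with τ hτ
    have hsub : ∀ i, IntervalIntegrable (u i) volume 0 τ := fun i => by
      refine (hu1 i).mono_set ?_
      rw [uIcc_of_le hT.le, uIcc_of_le hτ.1]
      exact Icc_subset_Icc_right hτ.2
    have l1 := isLinearMap_pairing p (U τ).toDual
    have l2 := isLinearMap_pairing p D
    have l3 := isLinearMap_boundaryPairing hL D
    have l4 := G.isLinearMap_controlPairing hL hsub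
    constructor
    · intro x y
      have h4 := l4.map_add x y
      simp only [Λ, H]
      rw [map_add, l1.map_add, l2.map_add, l3.map_add, h4]
      ring
    · intro c x
      have h4 := l4.map_smul c x
      simp only [Λ, H]
      rw [map_smul, l1.map_smul, l2.map_smul, l3.map_smul, h4]
      simp only [smul_eq_mul]
      ring
  · filter_upwards [hev] with τ hτ Y hY
    refine hΛ τ hτ Y fun i => ?_
    rw [← atLCLM_apply hL]
    exact hY i
  · filter_upwards [self_mem_nhdsWithin] with τ hτ
    exact sub_ne_zero.2 (ne_of_lt hτ)
  -- Since `H T (z j) = 0`, what remains of `Λ τ (z j)` is the pairing with `U τ` and the control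
  -- integral over `[τ, T]`, both `o(τ - T)`.
  · intro j
    have h1 := isLittleO_pairing hL hoU hV (W := fun τ => S τ (z j)) (fun i => by
      have h := (G.hasDerivAt_fn (z j) i T).isBigO_sub.mono (nhdsWithin_le_nhds (s := Iio T))
      simpa only [hz, hbf, sub_zero] using h) (hSv _) (hSb _)
    have h2 : (fun τ => ∑ i, ∫ t in τ..T, u i t * (p.bweight i * atL ((S t (z j)).pos i)))
        =o[𝓝[<] T] fun τ => τ - T :=
      Asymptotics.IsLittleO.fun_sum fun i _ =>
        isLittleO_integral_mul hT (hu1 i) ((hatz i j).const_mul_left _)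
    refine (h1.add h2).congr' (hev.mono fun τ hτ => ?_) EventuallyEq.rfl
    simp only [Λ, hHsub τ hτ, hHz]
    ring
  · intro i j
    have h1 := (G.hasDerivAt_atL (z j) i T).isLittleO.mono (nhdsWithin_le_nhds (s := Iio T))
    simp only [hz, hba, sub_zero] at h1
    refine h1.congr_left fun τ => ?_
    change _ = atLCLM p.L _ - _
    rw [atLCLM_apply hL]
    have h2 : (bvec p.L j).bvel i = if i = j then 1 else 0 := Pi.single_apply _ _ _
    rw [h2, smul_eq_mul, mul_ite, mul_one, mul_zero]
    rfl
  · intro i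
    exact hO ((atLCLM p.L).continuous.comp ((posC p.L i).continuous.comp (G.cont Z)))

end IsBeamGroup

end Moments
end LaminatedBeam
end

/-! ### The equivalence -/

theorem mainTheorem11 (p : LaminatedBeam.Params) (hp : p.Positive) (T : ℝ) (hT : 0 < T)
    (U₀ : LaminatedBeam.DualDatum p.L) (u : Fin 3 → ℝ → ℝ)
    (hu : ∀ i, MemLp (u i) 2 (volume.restrict (Ioo 0 T))) :
    LaminatedBeam.SteersToZero p T u U₀ ↔
      ∀ W : ℝ → LaminatedBeam.Phase p.L, LaminatedBeam.IsAdjointSolution p T W →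
        -(LaminatedBeam.pairing p U₀ (W 0)) - LaminatedBeam.boundaryPairing p U₀ (W 0) =
          3 * p.k * (∫ t in (0 : ℝ)..T, u 0 t * LaminatedBeam.atL ((W t).pos 0))
            + 3 * p.b * (∫ t in (0 : ℝ)..T, u 1 t * LaminatedBeam.atL ((W t).pos 1))
            + p.b * (∫ t in (0 : ℝ)..T, u 2 t * LaminatedBeam.atL ((W t).pos 2)) := by
  obtain ⟨R, S, G⟩ := LaminatedBeam.exists_isBeamGroup hp
  have hexp : ∀ W : ℝ → LaminatedBeam.Phase p.L,
      3 * p.k * (∫ t in (0 : ℝ)..T, u 0 t * LaminatedBeam.atL ((W t).pos 0))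
        + 3 * p.b * (∫ t in (0 : ℝ)..T, u 1 t * LaminatedBeam.atL ((W t).pos 1))
        + p.b * (∫ t in (0 : ℝ)..T, u 2 t * LaminatedBeam.atL ((W t).pos 2)) =
      LaminatedBeam.controlPairing p T u W := fun W => by
    rw [LaminatedBeam.controlPairing, Fin.sum_univ_three]
    rfl
  simp only [hexp]
  constructor
  · intro h W hW
    have hWS := G.eqOn_of_isAdjointSolution hp hW
    rw [LaminatedBeam.controlPairing_congr hT.le u hWS, hWS (left_mem_Icc.2 hT.le)]
    simp only [G.zero]
    exact G.moment_of_steersToZero hp hT hu h _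
  · intro h
    refine G.steersToZero hp hT.le hu fun Z => ?_
    exact h (fun t => S t Z) (G.isAdjointSolution_orbit T Z)
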